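/- Let $\mathbb K$ be a field of characteristic zero. For $n\ge 1$ and $1\le k\le n$ let $\mathrm{NCP}(k,n)$ be the set of noncrossing partitions of $[n]=\{1,\dots,n\}$ into $k$ blocks, and $\mathrm{NCP}=\bigsqcup_{1\le k\le n}\mathrm{NCP}(k,n)$. Partitions of other finite linearly ordered sets are identified with partitions of $[n]$ by the increasing bijection. For blocks $\pi,\rho$ of $P\in\mathrm{NCP}$ write $\pi\to\rho$ if $\rho=\pi$ or $\rho$ is nested inside $\pi$, i.e. if $\rho$ meets $[\min\pi,\max\pi]$; this is a partial order. A cut $(L,U)$ of $P$ is a splitting of the set of blocks into a lowerset $L$ (if $\rho\in L$ and $\pi\to\rho$ then $\pi\in L$) and its complement $U$. Let $\mathcal H$ be the free associative unital $\mathbb K$-algebra on the set $\mathrm{NCP}$, the empty partition being identified with $\mathbf 1$. Let $\varepsilon:\mathcal H\to\mathbb K$ be the character with $\varepsilon(P)=0$ for $P\in\mathrm{NCP}$, and let $\Delta:\mathcal H\to\mathcal H\otimes\mathcal H$ be the algebra morphism with $$\Delta(P)=\sum_{(L,U)\ \text{cut of}\ P} L\otimes \overline U ,\qquad P\in \mathrm{NCP},$$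 where $L$ is regarded as the partition induced on its underlying set $S$, and $\overline U$ is the product, from left to right, of the partitions induced by $P$ on the non-empty gaps of $S$ (the maximal sets of elements of $[n]\setminus S$ that are not separated by an element of $S$). On a monomial $w=P_1\cdots P_r$, $r\ge1$, put $\Delta_\prec(w)=\Delta_\prec(P_1)\Delta(P_2)\cdots\Delta(P_r)$ and $\Delta_\succ(w)=\Delta_\succ(P_1)\Delta(P_2)\cdots\Delta(P_r)$, where $\Delta_\prec(P)$ (resp. $\Delta_\succ(P)$) is the part of the sum $\Delta(P)$ over the cuts for which the element $1$ belongs to a block of $L$ (resp. of $U$). Let $\star,\prec,\succ$ be the products on linear forms on $\mathcal H$ dual to $\Delta,\Delta_\prec,\Delta_\succ$, i.e. $(f\otimes g)\circ\Delta$, etc.; $f\prec g$ and $f\succ g$ are set to $0$ at $\mathbf 1$. Let $e:\mathcal H\to\mathbb K$ be the linear form that vanishes at $\mathbf 1$ and at all products of two or more partitions, with $e(P)=1$ if $P\in\mathrm{NCP}$ has exactly one block and $e(P)=0$ for the other $P\in\mathrm{NCP}$. The universal characters $\psi_\prec,\psi_\succ,\psi_\star$ are the linear forms on $\mathcal H$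 determined by $$\psi_\prec=\varepsilon+e\prec\psi_\prec,\qquad \psi_\succ=\varepsilon+\psi_\succ\succ e,\qquad \psi_\star=\exp_\star(e)=\sum_{n\ge0}\frac{e^{\star n}}{n!}$$ (the two equations have unique solutions, the sum has only finitely many non-zero terms at each element, and the three forms are algebra morphisms $\mathcal H\to\mathbb K$). A noncrossing partition is called boolean if it is an iterated ordinal sum of single-block partitions (the ordinal sum puts one partition to the right of the other). A heap ordering of $P\in\mathrm{NCP}(k,n)$ is a bijection $\sigma$ from the set of its blocks to $[k]$ with $\sigma(\pi)\le\sigma(\rho)$ whenever $\pi\to\rho$; $\mathrm{ho}(P)$ is the number of heap orderings of $P$. **Theorem.** 1. $\psi_\prec(P)=1$ for every $P\in\mathrm{NCP}$. That is, $\psi_\prec$ corresponds to the zeta function: it is the composite of the canonical map from $\mathcal H$ onto the free commutative algebra on $\mathrm{NCP}$ with the character $\zeta$ of the latter that takes the value $1$ at every $P\in\mathrm{NCP}$. 2. For every $P\in\mathrm{NCP}$, $\psi_\succ(P)=1$ if $P$ is boolean, and $\psi_\succ(P)=0$ otherwise. 3. For every $P\in\mathrm{NCP}(k,n)$, $\psi_\star(P)=\mathrm{ho}(P)/k!$.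 -/

import Mathlib

open scoped TensorProduct

namespace NoncrossingShuffle

/-! ### Partitions of `Fin n` -/

/-- A partition of the linearly ordered set `Fin n`, as a set of (non-empty, disjoint) blocks. -/
abbrev SetPartition (n : ℕ) := Finpartition (Finset.univ : Finset (Fin n))

/-- There are no `a, b ∈ π` and `c, d ∈ ρ` in distinct blocks with `a < c < b < d`. -/
def IsNoncrossing {n : ℕ} (P : SetPartition n) : Prop :=
  ∀ π ∈ P.parts, ∀ ρ ∈ P.parts, π ≠ ρ →
    ∀ a ∈ π, ∀ b ∈ π, ∀ c ∈ ρ, ∀ d ∈ ρ, ¬ (a < c ∧ c < b ∧ b < d)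

/-- The standardization of the restriction of `P` to `S`: the blocks are the non-empty
intersections `π ∩ S`, transported along the increasing bijection `Fin #S ≃ S`. -/
def restrict {n : ℕ} (P : SetPartition n) (S : Finset (Fin n)) : SetPartition S.card :=
  Finpartition.ofErase
    (P.parts.image fun π => Finset.univ.filter fun i => S.orderEmbOfFin rfl i ∈ π)
    (by
      rw [Finset.supIndep_iff_pairwiseDisjoint]
      intro A hA B hB hAB
      simp only [Finset.coe_image, Set.mem_image, Finset.mem_coe] at hA hB
      obtain ⟨π, hπ, rfl⟩ := hA
      obtain ⟨ρ, hρ, rfl⟩ := hB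
      have hne : π ≠ ρ := fun h => hAB (by rw [h])
      have hd : Disjoint π ρ := P.disjoint hπ hρ hne
      simp only [Function.onFun, id, Finset.disjoint_left, Finset.mem_filter, Finset.mem_univ,
        true_and]
      exact fun i hi => Finset.disjoint_left.mp hd hi)
    (by
      ext i
      simp only [Finset.mem_sup, Finset.mem_image, id, Finset.mem_univ, iff_true]
      obtain ⟨π, hπ, hi⟩ := P.exists_mem (Finset.mem_univ (S.orderEmbOfFin rfl i))
      exact ⟨_, ⟨π, hπ, rfl⟩, by simpa using hi⟩)

theorem mem_parts_restrict {n : ℕ} (P : SetPartition n) (S : Finset (Fin n))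
    (A : Finset (Fin S.card)) :
    A ∈ (restrict P S).parts ↔ A ≠ ∅ ∧ ∃ π ∈ P.parts,
      (Finset.univ.filter fun i => S.orderEmbOfFin rfl i ∈ π) = A := by
  simp [restrict, Finpartition.ofErase]

theorem IsNoncrossing.restrict {n : ℕ} {P : SetPartition n} (h : IsNoncrossing P)
    (S : Finset (Fin n)) : IsNoncrossing (restrict P S) := by
  intro A hA B hB hAB a ha b hb c hc d hd
  obtain ⟨-, π, hπ, rfl⟩ := (mem_parts_restrict P S A).mp hA
  obtain ⟨-, ρ, hρ, rfl⟩ := (mem_parts_restrict P S B).mp hB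
  simp only [Finset.mem_filter, Finset.mem_univ, true_and] at ha hb hc hd
  have := h π hπ ρ hρ (fun e => hAB (by rw [e])) _ ha _ hb _ hc _ hd
  simpa using this

/-- The ordinal sum of a partition of `Fin m` and a partition of `Fin n`. -/
def ordinalSum {m n : ℕ} (P : SetPartition m) (Q : SetPartition n) : SetPartition (m + n) where
  parts := P.parts.image (Finset.map (Fin.castAddEmb n)) ∪
    Q.parts.image (Finset.map (Fin.natAddEmb m))
  supIndep := by
    rw [Finset.supIndep_iff_pairwiseDisjoint]
    intro A hA B hB hAB
    simp only [Finset.coe_union, Finset.coe_image, Set.mem_union, Set.mem_image,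
      Finset.mem_coe] at hA hB
    simp only [Function.onFun, id]
    rcases hA with ⟨π, hπ, rfl⟩ | ⟨π, hπ, rfl⟩ <;> rcases hB with ⟨ρ, hρ, rfl⟩ | ⟨ρ, hρ, rfl⟩
    · exact (Finset.disjoint_map _).mpr (P.disjoint hπ hρ fun e => hAB (by rw [e]))
    · simp only [Finset.disjoint_left, Finset.mem_map]
      rintro _ ⟨i, -, rfl⟩ ⟨j, -, h⟩
      have := congrArg Fin.val h
      simp at this
      omega
    · simp only [Finset.disjoint_left, Finset.mem_map]
      rintro _ ⟨i, -, rfl⟩ ⟨j, -, h⟩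
      have := congrArg Fin.val h
      simp at this
      omega
    · exact (Finset.disjoint_map _).mpr (Q.disjoint hπ hρ fun e => hAB (by rw [e]))
  sup_parts := by
    ext x
    simp only [Finset.mem_sup, Finset.mem_union, Finset.mem_image, id, Finset.mem_univ, iff_true]
    refine Fin.addCases (fun i => ?_) (fun j => ?_) x
    · obtain ⟨π, hπ, hi⟩ := P.exists_mem (Finset.mem_univ i)
      exact ⟨_, Or.inl ⟨π, hπ, rfl⟩, Finset.mem_map.mpr ⟨i, hi, rfl⟩⟩
    · obtain ⟨π, hπ, hj⟩ := Q.exists_mem (Finset.mem_univ j)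
      exact ⟨_, Or.inr ⟨π, hπ, rfl⟩, Finset.mem_map.mpr ⟨j, hj, rfl⟩⟩
  bot_notMem := by
    simp only [Finset.bot_eq_empty, Finset.mem_union, Finset.mem_image, Finset.map_eq_empty]
    rintro (⟨π, hπ, rfl⟩ | ⟨π, hπ, rfl⟩)
    · exact P.bot_notMem hπ
    · exact Q.bot_notMem hπ

theorem IsNoncrossing.ordinalSum {m n : ℕ} {P : SetPartition m} {Q : SetPartition n}
    (hP : IsNoncrossing P) (hQ : IsNoncrossing Q) : IsNoncrossing (ordinalSum P Q) := by
  intro A hA B hB hAB a ha b hb c hc d hd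
  simp only [NoncrossingShuffle.ordinalSum, Finset.mem_union, Finset.mem_image] at hA hB
  rcases hA with ⟨π, hπ, rfl⟩ | ⟨π, hπ, rfl⟩ <;> rcases hB with ⟨ρ, hρ, rfl⟩ | ⟨ρ, hρ, rfl⟩ <;>
    simp only [Finset.mem_map] at ha hb hc hd <;>
    obtain ⟨a, ha, rfl⟩ := ha <;> obtain ⟨b, hb, rfl⟩ := hb <;>
    obtain ⟨c, hc, rfl⟩ := hc <;> obtain ⟨d, hd, rfl⟩ := hd
  · exact hP π hπ ρ hρ (fun e => hAB (by rw [e])) a ha b hb c hc d hd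
  · rintro ⟨-, h, -⟩
    simp [Fin.lt_def] at h
    omega
  · rintro ⟨h, -, -⟩
    simp [Fin.lt_def] at h
    omega
  · have := hQ π hπ ρ hρ (fun e => hAB (by rw [e])) a ha b hb c hc d hd
    simp only [Fin.lt_def, Fin.natAddEmb_apply, Fin.val_natAdd] at this ⊢
    omega

/-! ### Non-empty noncrossing partitions -/

/-- A (standard) noncrossing partition of a non-empty set `{1, …, n}`, modelled on `Fin n`. -/
@[ext]
structure NCP where
  /-- the degree `n` -/
  deg : ℕ
  deg_pos : 0 < deg
  /-- the underlying partition -/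
  part : SetPartition deg
  noncrossing : IsNoncrossing part

namespace NCP

/-- The number `k` of blocks. -/
def numBlocks (P : NCP) : ℕ := P.part.parts.card

/-- The first element of the underlying linearly ordered set. -/
def first (P : NCP) : Fin P.deg := ⟨0, P.deg_pos⟩

/-- The block `ρ` meets the convex hull of the block `π`. On the blocks of a noncrossing
partition this relation is a partial order: `ρ = π` or `ρ` is nested inside `π`. -/
def Nests {n : ℕ} (π ρ : Finset (Fin n)) : Prop :=
  ∃ x ∈ ρ, ∃ a ∈ π, ∃ b ∈ π, a ≤ x ∧ x ≤ b

/-- A set `L` of blocks which contains all blocks that englobe one of its members. -/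
def IsLowerset (P : NCP) (L : Finset (Finset (Fin P.deg))) : Prop :=
  L ⊆ P.part.parts ∧ ∀ π ∈ L, ∀ σ ∈ P.part.parts, Nests σ π → σ ∈ L

open Classical in
/-- The cuts `(L, U)` of `P`; a cut is recorded by its lowerset `L`, and `U` is the complement. -/
noncomputable def cuts (P : NCP) : Finset (Finset (Finset (Fin P.deg))) :=
  P.part.parts.powerset.filter P.IsLowerset

/-- The underlying set of a set of blocks. -/
def support {n : ℕ} (L : Finset (Finset (Fin n))) : Finset (Fin n) := L.biUnion id

/-- A heap ordering: a numbering of the blocks by `1, …, k` for which nested blocks get higher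
numbers. -/
def HeapOrdering (P : NCP) : Type :=
  {σ : {π // π ∈ P.part.parts} ≃ Fin P.numBlocks //
    ∀ π ρ : {π // π ∈ P.part.parts}, Nests π.1 ρ.1 → σ π ≤ σ ρ}

/-- The number of heap orderings. -/
noncomputable def ho (P : NCP) : ℕ := Nat.card P.HeapOrdering

/-- The ordinal sum of non-empty noncrossing partitions. -/
def ordinalSum (P Q : NCP) : NCP where
  deg := P.deg + Q.deg
  deg_pos := Nat.add_pos_left P.deg_pos _
  part := NoncrossingShuffle.ordinalSum P.part Q.part
  noncrossing := P.noncrossing.ordinalSum Q.noncrossing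

/-- Iterated ordinal sums of single-block partitions. -/
inductive IsBoolean : NCP → Prop
  | single (P : NCP) (hP : P.numBlocks = 1) : IsBoolean P
  | sum (P Q : NCP) (hP : IsBoolean P) (hQ : IsBoolean Q) : IsBoolean (P.ordinalSum Q)

end NCP

/-! ### The gap-insertion Hopf algebra of noncrossing partitions -/

section Hopf

variable (K : Type*) [Field K]

/-- As an algebra, the Hopf algebra is the free associative algebra on the non-empty noncrossing
partitions; the empty partition is identified with the unit. -/
abbrev H := FreeAlgebra K NCP

/-- The multipartitions (noncommutative monomials of partitions) form a linear basis. -/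
noncomputable def monomialBasis : Module.Basis (FreeMonoid NCP) K (H K) :=
  FreeAlgebra.basisFreeMonoid K NCP

/-- The standardized restriction of `P` to `S` as an element of the Hopf algebra; it is the unit
when `S` is empty. -/
noncomputable def st (P : NCP) (S : Finset (Fin P.deg)) : H K :=
  if h : 0 < S.card then
    FreeAlgebra.ι K ⟨S.card, h, restrict P.part S, P.noncrossing.restrict S⟩
  else 1

/-- The `i`-th gap of `S = {x₁ < ⋯ < xₛ}`: the elements strictly between `xᵢ` and `xᵢ₊₁`
(below `x₁` for `i = 0`, above `xₛ` for `i = s`). -/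
def gap {n : ℕ} (S : Finset (Fin n)) (i : ℕ) : Finset (Fin n) :=
  Finset.univ.filter fun y => y ∉ S ∧ (S.filter fun x => x < y).card = i

/-- The reduced gap monomial of the cut whose lowerset has underlying set `S`: the ordered product
of the standardized restrictions of `P` to the gaps of `S`, empty gaps contributing `1`. -/
noncomputable def gapMonomial (P : NCP) (S : Finset (Fin P.deg)) : H K :=
  ((List.range (S.card + 1)).map fun i => st K P (gap S i)).prod

/-- The tensor `L ⊗ U` attached to a cut, with `U` the reduced gap monomial. -/
noncomputable def cutTerm (P : NCP) (L : Finset (Finset (Fin P.deg))) : H K ⊗[K] H K :=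
  st K P (NCP.support L) ⊗ₜ[K] gapMonomial K P (NCP.support L)

/-- The coproduct `Δ`, the multiplicative extension of the sum over all cuts. -/
noncomputable def coproduct : H K →ₐ[K] H K ⊗[K] H K :=
  FreeAlgebra.lift K fun P => ∑ L ∈ P.cuts, cutTerm K P L

/-- The coproduct `Δ_≺`: on a non-empty multipartition, the sum over the cuts for which the first
element belongs to the lowerset. The first element lies in the first factor `P` of a monomial
`P · w`, and a cut of `P · w` is a cut of `P` together with a cut of `w`. The value at the unit,
where `Δ_≺` is not defined, is set to `0`. -/
noncomputable def coproductPrec : H K →ₗ[K] H K ⊗[K] H K :=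
  (monomialBasis K).constr K fun w => match FreeMonoid.toList w with
    | [] => 0
    | P :: w' => (∑ L ∈ P.cuts with P.first ∈ NCP.support L, cutTerm K P L) *
        coproduct K (w'.map (FreeAlgebra.ι K)).prod

/-- The coproduct `Δ_≻`: on a non-empty multipartition, the sum over the cuts for which the first
element belongs to the upperset (and `0` at the unit). -/
noncomputable def coproductSucc : H K →ₗ[K] H K ⊗[K] H K :=
  (monomialBasis K).constr K fun w => match FreeMonoid.toList w with
    | [] => 0
    | P :: w' => (∑ L ∈ P.cuts with P.first ∉ NCP.support L, cutTerm K P L) *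
        coproduct K (w'.map (FreeAlgebra.ι K)).prod

/-- The counit, which vanishes on every non-empty partition. -/
noncomputable def counit : H K →ₐ[K] K := FreeAlgebra.lift K fun _ => 0

variable {K}

/-- The product `(f ⊗ g) ∘ D` of linear forms dual to a linear map `D : H → H ⊗ H`. -/
noncomputable def dualProduct (D : H K →ₗ[K] H K ⊗[K] H K) (f g : Module.Dual K (H K)) :
    Module.Dual K (H K) :=
  LinearMap.mul' K K ∘ₗ TensorProduct.map f g ∘ₗ D

/-- The convolution product `f ⋆ g`. -/
noncomputable def conv (f g : Module.Dual K (H K)) : Module.Dual K (H K) :=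
  dualProduct (coproduct K).toLinearMap f g

/-- The half-shuffle product `f ≺ g`. (With the values of `Δ_≺` on `P ⊗ 1` and `1 ⊗ P` terms this
includes the conventions `f ≺ ε = f` and `ε ≺ f = 0` for `f` vanishing at the unit.) -/
noncomputable def prec (f g : Module.Dual K (H K)) : Module.Dual K (H K) :=
  dualProduct (coproductPrec K) f g

/-- The half-shuffle product `f ≻ g`; it includes `ε ≻ f = f` and `f ≻ ε = 0` for `f` vanishing at
the unit. -/
noncomputable def succ (f g : Module.Dual K (H K)) : Module.Dual K (H K) :=
  dualProduct (coproductSucc K) f g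

/-- The convolution powers `f^{⋆n}`. -/
noncomputable def convPow (f : Module.Dual K (H K)) : ℕ → Module.Dual K (H K)
  | 0 => (counit K).toLinearMap
  | n + 1 => conv (convPow f n) f

/-- `φ` solves the left half-shuffle fixed point equation `φ = ε + κ ≺ φ`. -/
def IsLeftHalfShuffleExp (κ φ : Module.Dual K (H K)) : Prop :=
  φ = (counit K).toLinearMap + prec κ φ

/-- `φ` solves the right half-shuffle fixed point equation `φ = ε + φ ≻ κ`. -/
def IsRightHalfShuffleExp (κ φ : Module.Dual K (H K)) : Prop :=
  φ = (counit K).toLinearMap + succ φ κ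

/-- `φ = exp_⋆(κ) = ∑ₙ κ^{⋆n} / n!`, a sum with finitely many non-zero terms at each element. -/
def IsConvExp (κ φ : Module.Dual K (H K)) : Prop :=
  ∀ x : H K, (Function.support fun n : ℕ => convPow κ n x).Finite ∧
    φ x = ∑ᶠ n : ℕ, (n.factorial : K)⁻¹ * convPow κ n x

variable (K)

/-- The infinitesimal character `e`: it vanishes at the unit and on all products of two or more
partitions, and its value at a partition is `1` if there is just one block and `0` otherwise. -/
noncomputable def e : Module.Dual K (H K) :=
  (monomialBasis K).constr K fun w => match FreeMonoid.toList w with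
    | [P] => if P.numBlocks = 1 then 1 else 0
    | _ => 0

/-! ### The zeta function -/

/-- The algebra underlying the block-substitution bialgebra: the free commutative algebra on the
non-empty noncrossing partitions. -/
abbrev B := MvPolynomial NCP K

/-- The zeta function: the character with value `1` at every partition. -/
noncomputable def zeta : B K →ₐ[K] K := MvPolynomial.aeval fun _ => 1

/-- The abelianization, through which characters of `B` are identified with those of `H`. -/
noncomputable def abelianization : H K →ₐ[K] B K := FreeAlgebra.lift K MvPolynomial.X

end Hopf

end NoncrossingShuffle

namespace NoncrossingShuffle

/-! ### Monomial-wise recursions for the half-coproducts, the counit and `e` -/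

section Algebra

variable {K : Type*} [Field K]

/-! Since `e` only sees single blocks, each of the three defining equations turns into a recursion
that removes one block at a time.

For `≺`, evaluate on P·x and let B be the block of the first element. Only the cut with lowerset {B}
contributes; it is a cut because any other block englobing B would cross it. Hence φ(P x) = φ(U x),
where U is the gap monomial of B (`prec_e_ι_mul`). The factors of U have smaller degree than P, so
induction gives φ(P x) = φ(x), and every partition has value 1.

For `≻`, the upperset must be a single block containing the first element, so again B. Its removal
leaves a lowerset exactly when nothing is nested inside B, that is, when B is an interval
(`succ_e_ι_mul`). Boolean partitions are those whose blocks are all intervals, and their indicator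
obeys the same recursion (`booleanCharacter_ι`).

For `⋆`, the map D = (id ⊗ e) ∘ Δ is a derivation summing over deletions of a block with nothing
nested inside, and e^{⋆n} = ε ∘ D^n (`convPow_e`). Removing the last block of a heap ordering gives
ho(P) = ∑ ho(P ∖ ρ) over such blocks ρ, so the character χ(P) = ho(P)/k! satisfies χ ∘ D = k χ on
elements with k blocks. Iterating, e^{⋆m} is k! χ if m = k and 0 otherwise, and the exponential
series leaves χ.

The combinatorial input shared by the last two cases is `e_gapMonomial`. Coassociativity is never
used, and multiplicativity of a solution is derived rather than assumed. -/

theorem monomialBasis_one : monomialBasis K 1 = 1 := by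
  simp [monomialBasis, FreeAlgebra.basisFreeMonoid, FreeAlgebra.equivMonoidAlgebraFreeMonoid,
    MonoidAlgebra.coeffLinearEquiv]

theorem monomialBasis_of_mul (P : NCP) (w : FreeMonoid NCP) :
    monomialBasis K (FreeMonoid.of P * w) = FreeAlgebra.ι K P * monomialBasis K w := by
  simp [monomialBasis, FreeAlgebra.basisFreeMonoid, FreeAlgebra.equivMonoidAlgebraFreeMonoid,
    MonoidAlgebra.coeffLinearEquiv]

theorem monomialBasis_eq_prod (w : FreeMonoid NCP) :
    monomialBasis K w = (w.toList.map (FreeAlgebra.ι K)).prod := by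
  induction w using FreeMonoid.inductionOn' with
  | one => simp [monomialBasis_one]
  | of_mul P w ih => simp [monomialBasis_of_mul, ih]

/-- Two linear maps agree if they agree at the unit and left multiplication by generators preserves
their agreement. -/
theorem linearMap_ext_of_ι_mul {M : Type*} [AddCommGroup M] [Module K M] {f g : H K →ₗ[K] M}
    (h1 : f 1 = g 1)
    (hmul : ∀ P x, f x = g x → f (FreeAlgebra.ι K P * x) = g (FreeAlgebra.ι K P * x)) :
    f = g := by
  refine (monomialBasis K).ext fun w => ?_
  induction w using FreeMonoid.inductionOn' with
  | one => simpa [monomialBasis_one] using h1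
  | of_mul P w ih => simpa [monomialBasis_of_mul] using hmul P _ ih

theorem coproductPrec_one : coproductPrec K 1 = 0 := by
  rw [← monomialBasis_one, coproductPrec, Module.Basis.constr_basis]
  rfl

theorem coproductSucc_one : coproductSucc K 1 = 0 := by
  rw [← monomialBasis_one, coproductSucc, Module.Basis.constr_basis]
  rfl

theorem coproductPrec_ι_mul (P : NCP) (x : H K) :
    coproductPrec K (FreeAlgebra.ι K P * x) =
      (∑ L ∈ P.cuts with P.first ∈ NCP.support L, cutTerm K P L) * coproduct K x := by
  suffices h : coproductPrec K ∘ₗ LinearMap.mulLeft K (FreeAlgebra.ι K P) =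
      LinearMap.mulLeft K (∑ L ∈ P.cuts with P.first ∈ NCP.support L, cutTerm K P L) ∘ₗ
        (coproduct K).toLinearMap from LinearMap.congr_fun h x
  refine (monomialBasis K).ext fun w => ?_
  simp only [LinearMap.comp_apply, LinearMap.mulLeft_apply, ← monomialBasis_of_mul,
    AlgHom.toLinearMap_apply]
  rw [coproductPrec, Module.Basis.constr_basis, monomialBasis_eq_prod]
  rfl

theorem coproductSucc_ι_mul (P : NCP) (x : H K) :
    coproductSucc K (FreeAlgebra.ι K P * x) =
      (∑ L ∈ P.cuts with P.first ∉ NCP.support L, cutTerm K P L) * coproduct K x := by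
  suffices h : coproductSucc K ∘ₗ LinearMap.mulLeft K (FreeAlgebra.ι K P) =
      LinearMap.mulLeft K (∑ L ∈ P.cuts with P.first ∉ NCP.support L, cutTerm K P L) ∘ₗ
        (coproduct K).toLinearMap from LinearMap.congr_fun h x
  refine (monomialBasis K).ext fun w => ?_
  simp only [LinearMap.comp_apply, LinearMap.mulLeft_apply, ← monomialBasis_of_mul,
    AlgHom.toLinearMap_apply]
  rw [coproductSucc, Module.Basis.constr_basis, monomialBasis_eq_prod]
  rfl

@[simp]
theorem counit_ι (P : NCP) : counit K (FreeAlgebra.ι K P) = 0 := by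
  simp [counit]

@[simp]
theorem e_one : e K 1 = 0 := by
  rw [← monomialBasis_one, e, Module.Basis.constr_basis]
  rfl

/-- The counit records that nothing may follow P in the monomial. -/
theorem e_ι_mul (P : NCP) (x : H K) :
    e K (FreeAlgebra.ι K P * x) = (if P.numBlocks = 1 then 1 else 0) * counit K x := by
  suffices h : e K ∘ₗ LinearMap.mulLeft K (FreeAlgebra.ι K P) =
      (if P.numBlocks = 1 then 1 else 0 : K) • (counit K).toLinearMap by
    exact LinearMap.congr_fun h x
  refine (monomialBasis K).ext fun w => ?_
  simp only [LinearMap.comp_apply, LinearMap.mulLeft_apply, ← monomialBasis_of_mul,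
    AlgHom.toLinearMap_apply, LinearMap.smul_apply]
  rw [e, Module.Basis.constr_basis]
  induction w using FreeMonoid.casesOn with
  | one => simp [monomialBasis_one]
  | of_mul Q w => simp [monomialBasis_of_mul]

@[simp]
theorem e_ι (P : NCP) : e K (FreeAlgebra.ι K P) = if P.numBlocks = 1 then 1 else 0 := by
  simpa using e_ι_mul (K := K) P 1

/-- The form `e` is an infinitesimal character. -/
theorem e_mul (x y : H K) : e K (x * y) = e K x * counit K y + counit K x * e K y := by
  suffices h : e K ∘ₗ LinearMap.mulRight K y =
      counit K y • e K + e K y • (counit K).toLinearMap by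
    simpa [mul_comm] using LinearMap.congr_fun h x
  refine linearMap_ext_of_ι_mul (by simp) fun P x _ => ?_
  simp [mul_assoc, e_ι_mul]
  ring_nf

/-! ### Contractions of the tensor square -/

/-- The contraction `ε ⊗ id`. -/
noncomputable def counitLeft : H K ⊗[K] H K →ₐ[K] H K :=
  (Algebra.TensorProduct.lid K (H K)).toAlgHom.comp
    (Algebra.TensorProduct.map (counit K) (AlgHom.id K _))

/-- The contraction `id ⊗ ε`. -/
noncomputable def counitRight : H K ⊗[K] H K →ₐ[K] H K :=
  (Algebra.TensorProduct.rid K K (H K)).toAlgHom.comp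
    (Algebra.TensorProduct.map (AlgHom.id K _) (counit K))

/-- The contraction `id ⊗ e`. -/
noncomputable def eRight : H K ⊗[K] H K →ₗ[K] H K :=
  (TensorProduct.rid K (H K)).toLinearMap ∘ₗ TensorProduct.map LinearMap.id (e K)

@[simp]
theorem counitLeft_tmul (x y : H K) : counitLeft (x ⊗ₜ[K] y) = counit K x • y := by
  simp [counitLeft]

@[simp]
theorem counitRight_tmul (x y : H K) : counitRight (x ⊗ₜ[K] y) = counit K y • x := by
  simp [counitRight]

@[simp]
theorem eRight_tmul (x y : H K) : eRight (x ⊗ₜ[K] y) = e K y • x := by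
  simp [eRight]

/-- Inherited from the Leibniz rule of `e` over the counit, applied in the right leg. -/
theorem eRight_mul (X Y : H K ⊗[K] H K) :
    eRight (X * Y) = eRight X * counitRight Y + counitRight X * eRight Y := by
  induction X using TensorProduct.induction_on with
  | zero => simp
  | add X X' h h' => simp only [add_mul, map_add, h, h']; abel
  | tmul x x' =>
    induction Y using TensorProduct.induction_on with
    | zero => simp
    | add Y Y' h h' => simp only [mul_add, map_add, h, h']; abel
    | tmul y y' =>
      simp only [Algebra.TensorProduct.tmul_mul_tmul, eRight_tmul, counitRight_tmul, e_mul,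
        smul_mul_assoc, mul_smul_comm, smul_smul, add_smul]
      rw [mul_comm (e K x'), mul_comm (e K y')]

/-- The hypothesis `hs` kills the Leibniz term in which `e` falls on X; in the other term X is
contracted by the counit. It holds for cuts with non-empty lowerset, in particular for all those in
`≺`. -/
theorem map_e_left_mul (φ : Module.Dual K (H K)) {s : H K} (hs : counit K s = 0) (u : H K)
    (X : H K ⊗[K] H K) :
    LinearMap.mul' K K (TensorProduct.map (e K) φ ((s ⊗ₜ[K] u) * X)) =
      e K s * φ (u * counitLeft X) := by
  induction X using TensorProduct.induction_on with
  | zero => simp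
  | add X X' h h' => simp only [mul_add, map_add, h, h']
  | tmul x x' => simp [e_mul, hs, mul_assoc]

theorem map_e_right (φ : Module.Dual K (H K)) (X : H K ⊗[K] H K) :
    LinearMap.mul' K K (TensorProduct.map φ (e K) X) = φ (eRight X) := by
  induction X using TensorProduct.induction_on with
  | zero => simp
  | add X X' h h' => simp only [map_add, h, h']
  | tmul x x' => simp [mul_comm]

end Algebra

/-! ### Restrictions to unions of blocks -/

theorem SetPartition.eq_of_mem_of_mem {n : ℕ} (P : SetPartition n) {π ρ : Finset (Fin n)}
    (hπ : π ∈ P.parts) (hρ : ρ ∈ P.parts) {x : Fin n} (hx : x ∈ π) (hx' : x ∈ ρ) : π = ρ :=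
  P.disjoint.elim_finset hπ hρ x hx hx'

/-- The preimage of `π` under the increasing bijection `Fin #S ≃ S`. -/
def pull {n : ℕ} (S π : Finset (Fin n)) : Finset (Fin S.card) :=
  Finset.univ.filter fun i => S.orderEmbOfFin rfl i ∈ π

@[simp]
theorem mem_pull {n : ℕ} {S π : Finset (Fin n)} {i : Fin S.card} :
    i ∈ pull S π ↔ S.orderEmbOfFin rfl i ∈ π := by
  simp [pull]

theorem exists_orderEmbOfFin_eq {n : ℕ} {S : Finset (Fin n)} {x : Fin n} (hx : x ∈ S) :
    ∃ i, S.orderEmbOfFin rfl i = x := by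
  have : x ∈ Set.range (S.orderEmbOfFin rfl) := by simpa using hx
  exact this

namespace NCP

@[simp]
theorem mem_support {n : ℕ} {M : Finset (Finset (Fin n))} {x : Fin n} :
    x ∈ support M ↔ ∃ π ∈ M, x ∈ π := by
  simp [support]

theorem subset_support {n : ℕ} {M : Finset (Finset (Fin n))} {π : Finset (Fin n)} (hπ : π ∈ M) :
    π ⊆ support M := fun _ hx => mem_support.2 ⟨π, hπ, hx⟩

theorem parts_nonempty (P : NCP) {π : Finset (Fin P.deg)} (hπ : π ∈ P.part.parts) : π.Nonempty :=
  P.part.nonempty_of_mem_parts hπ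

/-- Over a union of blocks every block is either kept whole or disappears, so blocks of the
restriction correspond to members of M. -/
theorem mem_parts_restrict_support (P : NCP) {M : Finset (Finset (Fin P.deg))}
    (hM : M ⊆ P.part.parts) (A : Finset (Fin (support M).card)) :
    A ∈ (NoncrossingShuffle.restrict P.part (support M)).parts ↔
      ∃ π ∈ M, pull (support M) π = A := by
  rw [mem_parts_restrict]
  constructor
  · rintro ⟨hA, π, hπ, rfl⟩
    obtain ⟨i, hi⟩ := Finset.nonempty_iff_ne_empty.2 hA
    rw [Finset.mem_filter] at hi
    obtain ⟨ρ, hρ, hiρ⟩ := mem_support.1 ((support M).orderEmbOfFin_mem rfl i)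
    refine ⟨π, ?_, rfl⟩
    rwa [P.part.eq_of_mem_of_mem hπ (hM hρ) hi.2 hiρ]
  · rintro ⟨π, hπ, rfl⟩
    refine ⟨?_, π, hM hπ, rfl⟩
    obtain ⟨x, hx⟩ := P.parts_nonempty (hM hπ)
    obtain ⟨i, rfl⟩ := exists_orderEmbOfFin_eq (subset_support hπ hx)
    exact Finset.nonempty_iff_ne_empty.1 ⟨i, mem_pull.2 hx⟩

theorem pull_support_injOn (P : NCP) {M : Finset (Finset (Fin P.deg))} (hM : M ⊆ P.part.parts) :
    Set.InjOn (pull (support M)) (M : Set (Finset (Fin P.deg))) := by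
  intro π hπ ρ hρ h
  obtain ⟨x, hx⟩ := P.parts_nonempty (hM hπ)
  obtain ⟨i, rfl⟩ := exists_orderEmbOfFin_eq (subset_support hπ hx)
  have : i ∈ pull (support M) ρ := h ▸ mem_pull.2 hx
  exact P.part.eq_of_mem_of_mem (hM hπ) (hM hρ) hx (mem_pull.1 this)

theorem card_parts_restrict_support (P : NCP) {M : Finset (Finset (Fin P.deg))}
    (hM : M ⊆ P.part.parts) :
    (NoncrossingShuffle.restrict P.part (support M)).parts.card = M.card := by
  rw [← Finset.card_image_of_injOn (P.pull_support_injOn hM)]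
  congr 1
  ext A
  simp [mem_parts_restrict_support P hM]

theorem support_eq_empty (P : NCP) {M : Finset (Finset (Fin P.deg))} (hM : M ⊆ P.part.parts) :
    support M = ∅ ↔ M = ∅ := by
  constructor
  · intro h
    by_contra hne
    obtain ⟨π, hπ⟩ := Finset.nonempty_iff_ne_empty.2 hne
    obtain ⟨x, hx⟩ := P.parts_nonempty (hM hπ)
    have := subset_support hπ hx
    simp [h] at this
  · rintro rfl
    simp [support]

theorem compl_support (P : NCP) {M : Finset (Finset (Fin P.deg))} (hM : M ⊆ P.part.parts) :
    (support M)ᶜ = support (P.part.parts \ M) := by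
  ext x
  simp only [Finset.mem_compl, mem_support, Finset.mem_sdiff, not_exists, not_and]
  obtain ⟨π, hπ, hx⟩ := P.part.exists_mem (Finset.mem_univ x)
  constructor
  · exact fun h => ⟨π, ⟨hπ, fun h' => h π h' hx⟩, hx⟩
  · rintro ⟨ρ, ⟨hρ, hρM⟩, hxρ⟩ σ hσ hxσ
    exact hρM (P.part.eq_of_mem_of_mem hρ (hM hσ) hxρ hxσ ▸ hσ)

theorem support_eq_univ (P : NCP) {M : Finset (Finset (Fin P.deg))} (hM : M ⊆ P.part.parts) :
    support M = Finset.univ ↔ M = P.part.parts := by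
  rw [← Finset.compl_eq_empty_iff, P.compl_support hM, P.support_eq_empty Finset.sdiff_subset,
    Finset.sdiff_eq_empty_iff_subset]
  exact ⟨fun h => hM.antisymm h, fun h => h.ge⟩

theorem support_parts (P : NCP) : support P.part.parts = Finset.univ :=
  (P.support_eq_univ subset_rfl).2 rfl

theorem numBlocks_pos (P : NCP) : 0 < P.numBlocks := by
  obtain ⟨π, hπ, -⟩ := P.part.exists_mem (Finset.mem_univ P.first)
  exact Finset.card_pos.2 ⟨π, hπ⟩

/-- The standardized restriction to a non-empty set. -/
abbrev restrict (P : NCP) (S : Finset (Fin P.deg)) (hS : 0 < S.card) : NCP :=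
  ⟨S.card, hS, NoncrossingShuffle.restrict P.part S, P.noncrossing.restrict S⟩

theorem numBlocks_restrict_support (P : NCP) {M : Finset (Finset (Fin P.deg))}
    (hM : M ⊆ P.part.parts) (h : 0 < (support M).card) :
    (P.restrict (support M) h).numBlocks = M.card :=
  P.card_parts_restrict_support hM

/-- An increasing map which carries blocks to blocks identifies partitions of the same degree. -/
theorem eq_of_strictMono {P Q : NCP} (hdeg : P.deg = Q.deg) (f : Fin P.deg → Fin Q.deg)
    (hf : StrictMono f) (hparts : ∀ A ∈ P.part.parts, A.image f ∈ Q.part.parts) : P = Q := by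
  obtain ⟨n, hn, P, hP⟩ := P
  obtain ⟨m, hm, Q, hQ⟩ := Q
  obtain rfl : n = m := hdeg
  simp only at f hf hparts
  -- A strictly increasing self-map of `Fin n` is onto, and strictly increasing maps are determined
  -- by their range.
  obtain rfl : f = id := by
    rw [← hf.range_inj strictMono_id, Set.range_id]
    exact (Finite.injective_iff_surjective.1 hf.injective).range_eq
  simp only [Finset.image_id] at hparts
  obtain rfl : P = Q := by
    refine Finpartition.ext (Finset.Subset.antisymm hparts fun B hB => ?_)
    obtain ⟨b, hb⟩ := Q.nonempty_of_mem_parts hB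
    obtain ⟨A, hA, hbA⟩ := P.exists_mem (Finset.mem_univ b)
    rwa [Q.eq_of_mem_of_mem hB (hparts A hA) hb hbA]
  rfl

theorem restrict_univ (P : NCP) (h : 0 < (Finset.univ : Finset (Fin P.deg)).card) :
    P.restrict Finset.univ h = P := by
  have hf : StrictMono (Finset.univ.orderEmbOfFin rfl : Fin _ → Fin P.deg) :=
    OrderEmbedding.strictMono _
  refine eq_of_strictMono (P := P.restrict Finset.univ h) (by simp) _ hf fun A hA => ?_
  obtain ⟨-, π, hπ, rfl⟩ := (mem_parts_restrict _ _ _).1 hA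
  convert hπ
  ext x
  obtain ⟨i, rfl⟩ := exists_orderEmbOfFin_eq (Finset.mem_univ x)
  refine Finset.mem_image.trans ⟨?_, ?_⟩
  · rintro ⟨j, hj, h⟩
    rw [← h]
    exact (Finset.mem_filter.1 hj).2
  · exact fun h => ⟨i, Finset.mem_filter.2 ⟨Finset.mem_univ _, h⟩, rfl⟩

theorem mem_cuts {P : NCP} {L : Finset (Finset (Fin P.deg))} :
    L ∈ P.cuts ↔ L ⊆ P.part.parts ∧
      ∀ π ∈ L, ∀ σ ∈ P.part.parts, Nests σ π → σ ∈ L := by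
  classical
  simp only [cuts, Finset.mem_filter, Finset.mem_powerset, IsLowerset]
  tauto

end NCP

/-! ### Counit and infinitesimal character on cuts -/

section Cuts

variable {K : Type*} [Field K]

theorem st_of_card_pos {P : NCP} {S : Finset (Fin P.deg)} (h : 0 < S.card) :
    st K P S = FreeAlgebra.ι K (P.restrict S h) := by
  simp [st, h, NCP.restrict]

@[simp]
theorem st_empty (P : NCP) : st K P ∅ = 1 := by
  simp [st]

@[simp]
theorem st_univ (P : NCP) : st K P Finset.univ = FreeAlgebra.ι K P := by
  have h : 0 < (Finset.univ : Finset (Fin P.deg)).card := by simpa using P.deg_pos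
  rw [st_of_card_pos h, P.restrict_univ]

theorem counit_st (P : NCP) (S : Finset (Fin P.deg)) :
    counit K (st K P S) = if S = ∅ then 1 else 0 := by
  split_ifs with h
  · simp [h]
  · rw [st_of_card_pos (Finset.card_pos.2 (Finset.nonempty_iff_ne_empty.2 h)), counit_ι]

theorem e_st_support (P : NCP) {M : Finset (Finset (Fin P.deg))} (hM : M ⊆ P.part.parts) :
    e K (st K P (NCP.support M)) = if M.card = 1 then 1 else 0 := by
  by_cases h : M = ∅
  · subst h
    simp [NCP.support]
  · have h' : 0 < (NCP.support M).card :=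
      Finset.card_pos.2 (Finset.nonempty_iff_ne_empty.2 fun h' => h ((P.support_eq_empty hM).1 h'))
    rw [st_of_card_pos h', e_ι, P.numBlocks_restrict_support hM]

theorem mem_gap {n : ℕ} {S : Finset (Fin n)} {i : ℕ} {y : Fin n} :
    y ∈ gap S i ↔ y ∉ S ∧ (S.filter fun x => x < y).card = i := by
  simp [gap]

theorem mem_gap_card {n : ℕ} {S : Finset (Fin n)} {y : Fin n} (hy : y ∉ S) :
    y ∈ gap S (S.filter fun x => x < y).card := mem_gap.2 ⟨hy, rfl⟩

theorem card_filter_lt_mem_range {n : ℕ} (S : Finset (Fin n)) (y : Fin n) :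
    (S.filter fun x => x < y).card ∈ Finset.range (S.card + 1) :=
  Finset.mem_range.2 (Nat.lt_succ_of_le (Finset.card_filter_le _ _))

theorem counit_prod_range (f : ℕ → H K) (m : ℕ) :
    counit K ((List.range m).map f).prod = ∏ j ∈ Finset.range m, counit K (f j) := by
  induction m with
  | zero => simp
  | succ m ih => simp [List.range_succ, Finset.prod_range_succ, ih]

/-- One non-empty gap already makes the counit vanish, and all gaps are empty only if S is
everything. -/
theorem counit_gapMonomial (P : NCP) (S : Finset (Fin P.deg)) :
    counit K (gapMonomial K P S) = if S = Finset.univ then 1 else 0 := by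
  rw [gapMonomial, counit_prod_range]
  simp only [counit_st]
  split_ifs with hS
  · refine Finset.prod_eq_one fun i _ => if_pos ?_
    ext y
    simp [mem_gap, hS]
  · obtain ⟨y, hy⟩ : ∃ y, y ∉ S := by simpa [Finset.eq_univ_iff_forall] using hS
    refine Finset.prod_eq_zero (card_filter_lt_mem_range S y) (if_neg ?_)
    exact Finset.nonempty_iff_ne_empty.1 ⟨y, mem_gap_card hy⟩

/-- The Leibniz rule iterated: `e` hits one factor and the counit all the others. -/
theorem e_prod_range (f : ℕ → H K) (m : ℕ) :
    e K ((List.range m).map f).prod =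
      ∑ i ∈ Finset.range m, e K (f i) * ∏ j ∈ (Finset.range m).erase i, counit K (f j) := by
  induction m with
  | zero => simp
  | succ m ih =>
    rw [List.range_succ, List.map_append, List.prod_append, e_mul, ih, counit_prod_range,
      Finset.sum_range_succ]
    have h1 : (Finset.range (m + 1)).erase m = Finset.range m := by
      ext; simp; omega
    rw [h1, Finset.sum_mul]
    congr 1
    · refine Finset.sum_congr rfl fun i hi => ?_
      have h2 : (Finset.range (m + 1)).erase i = insert m ((Finset.range m).erase i) := by
        rw [Finset.mem_range] at hi
        ext; simp; omega
      rw [h2, Finset.prod_insert (by simp)]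
      simp
      ring
    · simp [mul_comm]

/-- A non-zero value needs exactly one non-empty gap, carrying one block. Conversely, a single block
in the upperset is not split among several gaps, because L is a lowerset. -/
theorem e_gapMonomial (P : NCP) {L : Finset (Finset (Fin P.deg))} (hL : L ∈ P.cuts) :
    e K (gapMonomial K P (NCP.support L)) = if (P.part.parts \ L).card = 1 then 1 else 0 := by
  obtain ⟨hLP, hlow⟩ := NCP.mem_cuts.1 hL
  have hcompl := P.compl_support hLP
  set S := NCP.support L with hS
  rw [gapMonomial, e_prod_range]
  split_ifs with hcard
  · obtain ⟨ρ, hρ⟩ := Finset.card_eq_one.1 hcard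
    have hρ' : ρ ∈ P.part.parts ∧ ρ ∉ L := by
      rw [← Finset.mem_sdiff, hρ]; simp
    have hSρ : ∀ y, y ∉ S ↔ y ∈ ρ := by
      intro y
      rw [← Finset.mem_compl, hcompl, hρ]
      simp
    obtain ⟨a, ha⟩ := P.parts_nonempty hρ'.1
    -- An element x of S with z ≤ x < y would lie in a block of L nested inside ρ, forcing ρ ∈ L. So
    -- all elements of ρ have the same number of predecessors in S and share a gap.
    have hlt : ∀ y ∈ ρ, ∀ z ∈ ρ, (S.filter fun x => x < y) ⊆ S.filter fun x => x < z := by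
      intro y hy z hz x hx
      rw [Finset.mem_filter] at hx ⊢
      refine ⟨hx.1, ?_⟩
      by_contra hxz
      obtain ⟨π, hπ, hxπ⟩ := NCP.mem_support.1 hx.1
      exact hρ'.2 (hlow π hπ ρ hρ'.1 ⟨x, hxπ, z, hz, y, hy, not_lt.1 hxz, hx.2.le⟩)
    set j := (S.filter fun x => x < a).card with hj
    have hgap : ∀ i, gap S i = if i = j then ρ else ∅ := by
      intro i
      ext y
      rw [mem_gap, hSρ]
      by_cases hy : y ∈ ρ
      · have : S.filter (fun x => x < y) = S.filter fun x => x < a :=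
          (hlt y hy a ha).antisymm (hlt a ha y hy)
        rw [this, ← hj]
        split_ifs with h <;> simp [hy, h, eq_comm]
      · split_ifs <;> simp [hy]
    rw [Finset.sum_eq_single j]
    · have h1 : e K (st K P ρ) = 1 := by
        have := e_st_support (K := K) P (M := {ρ}) (by simpa using hρ'.1)
        simpa [NCP.support] using this
      rw [hgap, if_pos rfl, h1, one_mul]
      refine Finset.prod_eq_one fun i hi => ?_
      rw [hgap, if_neg (Finset.ne_of_mem_erase hi), st_empty, map_one]
    · intro i _ hi
      rw [hgap, if_neg hi, st_empty, e_one, zero_mul]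
    · exact fun h => absurd (card_filter_lt_mem_range S a) h
  · refine Finset.sum_eq_zero fun i hi => ?_
    -- If all other gaps are empty, gap i carries the whole upperset, which does not consist of one
    -- block; otherwise the counit of another non-empty gap vanishes.
    by_cases h : ∀ j ∈ (Finset.range (S.card + 1)).erase i, gap S j = ∅
    · have hgap : gap S i = NCP.support (P.part.parts \ L) := by
        rw [← hcompl]
        ext y
        rw [Finset.mem_compl]
        refine ⟨fun hy => (mem_gap.1 hy).1, fun hy => ?_⟩
        by_contra hyi
        have hne : (S.filter fun x => x < y).card ≠ i := fun h' => hyi (mem_gap.2 ⟨hy, h'⟩)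
        have := h _ (Finset.mem_erase.2 ⟨hne, card_filter_lt_mem_range S y⟩)
        simpa [this] using mem_gap_card hy
      rw [hgap, e_st_support P Finset.sdiff_subset, if_neg hcard, zero_mul]
    · push Not at h
      obtain ⟨j, hj, hne⟩ := h
      rw [Finset.prod_eq_zero hj, mul_zero]
      rw [counit_st, if_neg (Finset.nonempty_iff_ne_empty.1 hne)]

/-- Only the empty lowerset survives, and its unique gap is the whole of P. -/
theorem counitLeft_coproduct (x : H K) : counitLeft (coproduct K x) = x := by
  suffices h : counitLeft.comp (coproduct K) = AlgHom.id K (H K) from DFunLike.congr_fun h x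
  ext P
  simp only [Function.comp_apply, AlgHom.comp_apply, coproduct, FreeAlgebra.lift_ι_apply, map_sum,
    cutTerm, counitLeft_tmul, AlgHom.id_apply]
  rw [Finset.sum_eq_single ∅]
  · have hgap : gap (NCP.support (∅ : Finset (Finset (Fin P.deg)))) 0 = Finset.univ := by
      ext y; simp [mem_gap, NCP.support]
    simp [gapMonomial, NCP.support]
    simpa [NCP.support] using congrArg (st K P) hgap
  · intro L hL hne
    rw [counit_st, if_neg, zero_smul]
    rwa [P.support_eq_empty (NCP.mem_cuts.1 hL).1]
  · exact fun h => absurd (NCP.mem_cuts.2 (by simp)) h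

/-- Only the cut with empty upperset survives. -/
theorem counitRight_coproduct (x : H K) : counitRight (coproduct K x) = x := by
  suffices h : counitRight.comp (coproduct K) = AlgHom.id K (H K) from DFunLike.congr_fun h x
  ext P
  simp only [Function.comp_apply, AlgHom.comp_apply, coproduct, FreeAlgebra.lift_ι_apply, map_sum,
    cutTerm, counitRight_tmul, AlgHom.id_apply, counit_gapMonomial]
  rw [Finset.sum_eq_single P.part.parts]
  · simp [NCP.support_parts]
  · intro L hL hne
    rw [if_neg, zero_smul]
    rwa [P.support_eq_univ (NCP.mem_cuts.1 hL).1]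
  · refine fun h => absurd (NCP.mem_cuts.2 ⟨subset_rfl, ?_⟩) h
    exact fun _ _ σ hσ _ => hσ

end Cuts

/-! ### Ordinal sums, the first block, and boolean partitions as interval partitions -/

theorem mem_parts_ordinalSum {m n : ℕ} {P : SetPartition m} {Q : SetPartition n}
    {A : Finset (Fin (m + n))} : A ∈ (ordinalSum P Q).parts ↔
      (∃ π ∈ P.parts, π.map (Fin.castAddEmb n) = A) ∨
        ∃ π ∈ Q.parts, π.map (Fin.natAddEmb m) = A := by
  simp [ordinalSum]

theorem ordConnected_parts_ordinalSum {m n : ℕ} {P : SetPartition m} {Q : SetPartition n}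
    (hP : ∀ π ∈ P.parts, (π : Set (Fin m)).OrdConnected)
    (hQ : ∀ π ∈ Q.parts, (π : Set (Fin n)).OrdConnected) :
    ∀ A ∈ (ordinalSum P Q).parts, (A : Set (Fin (m + n))).OrdConnected := by
  intro A hA
  refine ⟨fun a ha b hb x hx => ?_⟩
  obtain ⟨h1, h2⟩ := hx
  rcases mem_parts_ordinalSum.1 hA with ⟨π, hπ, rfl⟩ | ⟨π, hπ, rfl⟩ <;>
    obtain ⟨i, hi, rfl⟩ := Finset.mem_map.1 (Finset.mem_coe.1 ha) <;>
    obtain ⟨j, hj, rfl⟩ := Finset.mem_map.1 (Finset.mem_coe.1 hb)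
  · exact Finset.mem_map.2 ⟨⟨x, lt_of_le_of_lt h2 j.2⟩, (hP π hπ).out hi hj ⟨h1, h2⟩, rfl⟩
  · simp only [Fin.le_def, Fin.natAddEmb_apply, Fin.val_natAdd] at h1 h2
    refine Finset.mem_map.2 ⟨⟨x - m, by omega⟩, (hQ π hπ).out hi hj ⟨?_, ?_⟩, ?_⟩
    · simp only [Fin.le_def]; omega
    · simp only [Fin.le_def]; omega
    · ext
      simp only [Fin.natAddEmb_apply, Fin.val_natAdd]
      omega

namespace NCP

/-- The block of the first element. -/
def firstBlock (P : NCP) : Finset (Fin P.deg) := P.part.part P.first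

theorem firstBlock_mem (P : NCP) : P.firstBlock ∈ P.part.parts :=
  P.part.part_mem.2 (Finset.mem_univ _)

theorem first_mem_firstBlock (P : NCP) : P.first ∈ P.firstBlock :=
  P.part.mem_part (Finset.mem_univ _)

theorem first_le (P : NCP) (x : Fin P.deg) : P.first ≤ x := Nat.zero_le _

theorem eq_firstBlock (P : NCP) {π : Finset (Fin P.deg)} (hπ : π ∈ P.part.parts)
    (h : P.first ∈ π) : π = P.firstBlock :=
  P.part.eq_of_mem_of_mem hπ P.firstBlock_mem h P.first_mem_firstBlock

theorem first_mem_support (P : NCP) {L : Finset (Finset (Fin P.deg))} (hL : L ⊆ P.part.parts) :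
    P.first ∈ support L ↔ P.firstBlock ∈ L := by
  rw [mem_support]
  constructor
  · rintro ⟨π, hπ, h⟩
    exact P.eq_firstBlock (hL hπ) h ▸ hπ
  · exact fun h => ⟨_, h, P.first_mem_firstBlock⟩

/-- Otherwise the first element, a, x, b would be strictly increasing and alternate between the
first block and σ, which is a crossing. -/
theorem eq_firstBlock_of_nests (P : NCP) {σ : Finset (Fin P.deg)} (hσ : σ ∈ P.part.parts)
    (h : Nests σ P.firstBlock) : σ = P.firstBlock := by
  obtain ⟨x, hx, a, ha, b, hb, hax, hxb⟩ := h
  by_contra hne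
  have hlt : ∀ {y z}, y ∈ σ → z ∈ P.firstBlock → y ≠ z := by
    rintro y _ hy hz rfl
    exact hne (P.part.eq_of_mem_of_mem hσ P.firstBlock_mem hy hz)
  refine P.noncrossing _ P.firstBlock_mem σ hσ (Ne.symm hne) P.first P.first_mem_firstBlock x hx
    a ha b hb ⟨?_, ?_, ?_⟩
  · exact lt_of_le_of_ne (P.first_le a) (hlt ha P.first_mem_firstBlock).symm
  · exact lt_of_le_of_ne hax (hlt ha hx)
  · exact lt_of_le_of_ne hxb (hlt hb hx).symm

theorem singleton_firstBlock_mem_cuts (P : NCP) : {P.firstBlock} ∈ P.cuts := by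
  rw [mem_cuts]
  refine ⟨by simpa using P.firstBlock_mem, fun π hπ σ hσ h => ?_⟩
  rw [Finset.mem_singleton] at hπ ⊢
  subst hπ
  exact P.eq_firstBlock_of_nests hσ h

/-- Removing a block leaves a lowerset if and only if nothing is nested inside this block. -/
theorem erase_mem_cuts (P : NCP) {ρ : Finset (Fin P.deg)} (hρ : ρ ∈ P.part.parts) :
    P.part.parts.erase ρ ∈ P.cuts ↔ ∀ π ∈ P.part.parts, Nests ρ π → π = ρ := by
  rw [mem_cuts]
  constructor
  · rintro ⟨-, h⟩ π hπ hN
    by_contra hne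
    simpa using h π (Finset.mem_erase.2 ⟨hne, hπ⟩) ρ hρ hN
  · refine fun h => ⟨Finset.erase_subset _ _, fun π hπ σ hσ hN => ?_⟩
    rw [Finset.mem_erase] at hπ ⊢
    refine ⟨?_, hσ⟩
    rintro rfl
    exact hπ.1 (h π hπ.2 hN)

/-- Nothing is nested inside a block exactly if the block is an interval. -/
theorem forall_nests_iff_ordConnected (P : NCP) {ρ : Finset (Fin P.deg)}
    (hρ : ρ ∈ P.part.parts) :
    (∀ π ∈ P.part.parts, Nests ρ π → π = ρ) ↔ (ρ : Set (Fin P.deg)).OrdConnected := by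
  constructor
  · refine fun h => ⟨fun a ha b hb x hx => ?_⟩
    obtain ⟨π, hπ, hxπ⟩ := P.part.exists_mem (Finset.mem_univ x)
    rw [← h π hπ ⟨x, hxπ, a, ha, b, hb, hx.1, hx.2⟩]
    exact hxπ
  · rintro h π hπ ⟨x, hx, a, ha, b, hb, hax, hxb⟩
    exact P.part.eq_of_mem_of_mem hπ hρ hx (h.out ha hb ⟨hax, hxb⟩)

/-- A partition that splits into unions of blocks over an initial and a final segment is an
ordinal sum. -/
theorem ordinalSum_restrict (P : NCP) {M : Finset (Finset (Fin P.deg))} (hM : M ⊆ P.part.parts)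
    (hS : 0 < (support M).card) (hT : 0 < (support (P.part.parts \ M)).card)
    (hlt : ∀ x ∈ support M, ∀ y ∈ support (P.part.parts \ M), x < y) :
    (P.restrict (support M) hS).ordinalSum (P.restrict (support (P.part.parts \ M)) hT) = P := by
  have hcompl := P.compl_support hM
  -- The increasing enumerations of the two segments, concatenated; `hlt` makes the result
  -- increasing.
  let f : Fin ((support M).card + (support (P.part.parts \ M)).card) → Fin P.deg :=
    Fin.addCases ((support M).orderEmbOfFin rfl)
      ((support (P.part.parts \ M)).orderEmbOfFin rfl)
  have hlow : ∀ i, f (Fin.castAdd _ i) = (support M).orderEmbOfFin rfl i :=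
    fun i => Fin.addCases_left i
  have hhigh : ∀ i, f (Fin.natAdd _ i) = (support (P.part.parts \ M)).orderEmbOfFin rfl i :=
    fun i => Fin.addCases_right i
  have hf : StrictMono f := by
    intro x y
    refine Fin.addCases (fun i => ?_) (fun i => ?_) x <;>
      refine Fin.addCases (fun j => ?_) (fun j => ?_) y <;> intro h
    · rw [hlow, hlow]
      exact ((support M).orderEmbOfFin rfl).strictMono (show i < j from h)
    · rw [hlow, hhigh]
      exact hlt _ (Finset.orderEmbOfFin_mem _ _ _) _ (Finset.orderEmbOfFin_mem _ _ _)
    · rw [Fin.lt_def, Fin.val_natAdd, Fin.val_castAdd] at h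
      omega
    · rw [hhigh, hhigh]
      exact OrderEmbedding.strictMono _ (show i < j from Nat.lt_of_add_lt_add_left h)
  refine eq_of_strictMono
    (P := (P.restrict (support M) hS).ordinalSum (P.restrict (support (P.part.parts \ M)) hT))
    ?_ f hf ?_
  · have := Finset.card_add_card_compl (support M)
    rw [hcompl, Fintype.card_fin] at this
    exact this
  · intro A hA
    rcases mem_parts_ordinalSum.1 hA with ⟨B, hB, rfl⟩ | ⟨B, hB, rfl⟩
    · obtain ⟨π, hπ, rfl⟩ := (P.mem_parts_restrict_support hM B).1 hB
      convert hM hπ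
      ext x
      refine Finset.mem_image.trans ⟨?_, fun hx => ?_⟩
      · rintro ⟨_, hy, rfl⟩
        obtain ⟨i, hi, rfl⟩ := Finset.mem_map.1 hy
        exact (hlow i).symm ▸ mem_pull.1 hi
      · obtain ⟨i, rfl⟩ := exists_orderEmbOfFin_eq (subset_support hπ hx)
        exact ⟨_, Finset.mem_map.2 ⟨i, mem_pull.2 hx, rfl⟩, hlow i⟩
    · obtain ⟨π, hπ, rfl⟩ := (P.mem_parts_restrict_support Finset.sdiff_subset B).1 hB
      convert (Finset.mem_sdiff.1 hπ).1
      ext x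
      refine Finset.mem_image.trans ⟨?_, fun hx => ?_⟩
      · rintro ⟨_, hy, rfl⟩
        obtain ⟨i, hi, rfl⟩ := Finset.mem_map.1 hy
        exact (hhigh i).symm ▸ mem_pull.1 hi
      · obtain ⟨i, rfl⟩ := exists_orderEmbOfFin_eq (subset_support hπ hx)
        exact ⟨_, Finset.mem_map.2 ⟨i, mem_pull.2 hx, rfl⟩, hhigh i⟩

theorem ordConnected_of_isBoolean {P : NCP} (h : P.IsBoolean) :
    ∀ π ∈ P.part.parts, (π : Set (Fin P.deg)).OrdConnected := by
  induction h with
  | single P hP =>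
    intro π hπ
    refine ⟨fun a ha b hb x hx => ?_⟩
    obtain ⟨ρ, hρ, hxρ⟩ := P.part.exists_mem (Finset.mem_univ x)
    rwa [Finset.card_le_one.1 hP.le π hπ ρ hρ]
  | sum P Q _ _ ihP ihQ => exact ordConnected_parts_ordinalSum ihP ihQ

theorem ordConnected_pull {n : ℕ} (S : Finset (Fin n)) {π : Finset (Fin n)}
    (h : (π : Set (Fin n)).OrdConnected) : (pull S π : Set (Fin S.card)).OrdConnected := by
  refine ⟨fun a ha b hb x hx => mem_pull.2 (h.out (mem_pull.1 ha) (mem_pull.1 hb) ?_)⟩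
  simpa using hx

theorem ordConnected_restrict_support (P : NCP) {M : Finset (Finset (Fin P.deg))}
    (hM : M ⊆ P.part.parts) (h : ∀ π ∈ M, (π : Set (Fin P.deg)).OrdConnected)
    (hS : 0 < (support M).card) :
    ∀ A ∈ (P.restrict (support M) hS).part.parts,
      (A : Set (Fin (P.restrict (support M) hS).deg)).OrdConnected := by
  intro A hA
  obtain ⟨π, hπ, rfl⟩ := (P.mem_parts_restrict_support hM A).1 hA
  exact ordConnected_pull _ (h π hπ)

theorem support_singleton {n : ℕ} (π : Finset (Fin n)) : support {π} = π := by
  simp [support]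

theorem lt_of_mem_firstBlock (P : NCP) (h : (P.firstBlock : Set (Fin P.deg)).OrdConnected)
    {x y : Fin P.deg} (hx : x ∈ P.firstBlock) (hy : y ∉ P.firstBlock) : x < y := by
  by_contra hxy
  exact hy (h.out P.first_mem_firstBlock hx ⟨P.first_le y, not_lt.1 hxy⟩)

/-- Boolean partitions are the partitions into intervals. -/
theorem isBoolean_iff_ordConnected (P : NCP) :
    P.IsBoolean ↔ ∀ π ∈ P.part.parts, (π : Set (Fin P.deg)).OrdConnected := by
  refine ⟨ordConnected_of_isBoolean, ?_⟩
  obtain ⟨n, hn⟩ : ∃ n, P.deg = n := ⟨_, rfl⟩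
  induction n using Nat.strong_induction_on generalizing P with
  | _ n ih =>
    intro hconv
    subst hn
    -- The first block, being an interval that contains the least element, precedes everything else;
    -- it splits off as an ordinal summand and the induction applies to the rest.
    have hB : {P.firstBlock} ⊆ P.part.parts := by simpa using P.firstBlock_mem
    have hS : 0 < (support {P.firstBlock}).card :=
      Finset.card_pos.2 ⟨P.first, by simpa using P.first_mem_firstBlock⟩
    by_cases hrest : P.part.parts \ {P.firstBlock} = ∅
    · refine .single P ?_
      rw [Finset.sdiff_eq_empty_iff_subset] at hrest
      rw [numBlocks, hrest.antisymm hB, Finset.card_singleton]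
    · have hT : 0 < (support (P.part.parts \ {P.firstBlock})).card :=
        Finset.card_pos.2 (Finset.nonempty_iff_ne_empty.2 fun h =>
          hrest ((P.support_eq_empty Finset.sdiff_subset).1 h))
      rw [← P.ordinalSum_restrict hB hS hT]
      · refine .sum _ _ (.single _ ?_) (ih _ ?_ _ rfl ?_)
        · rw [P.numBlocks_restrict_support hB, Finset.card_singleton]
        · have := Finset.card_add_card_compl (support {P.firstBlock})
          rw [P.compl_support hB, Fintype.card_fin] at this
          change (support _).card < _
          omega
        · exact P.ordConnected_restrict_support Finset.sdiff_subset
            (fun π hπ => hconv π (Finset.mem_sdiff.1 hπ).1) hT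
      · intro x hx y hy
        rw [← P.compl_support hB, Finset.mem_compl] at hy
        rw [support_singleton] at hx hy
        exact P.lt_of_mem_firstBlock (hconv _ P.firstBlock_mem) hx hy

/-- The partition without its first block is boolean if it is empty or boolean. -/
theorem isBoolean_iff_firstBlock (P : NCP) :
    P.IsBoolean ↔ (P.firstBlock : Set (Fin P.deg)).OrdConnected ∧
      ∀ hS : 0 < (support (P.part.parts.erase P.firstBlock)).card,
        (P.restrict (support (P.part.parts.erase P.firstBlock)) hS).IsBoolean := by
  have hsub := Finset.erase_subset P.firstBlock P.part.parts
  constructor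
  · intro h
    rw [isBoolean_iff_ordConnected] at h
    refine ⟨h _ P.firstBlock_mem, fun hS => ?_⟩
    rw [isBoolean_iff_ordConnected]
    exact P.ordConnected_restrict_support hsub (fun π hπ => h π (hsub hπ)) hS
  · rintro ⟨hB, h⟩
    rw [isBoolean_iff_ordConnected]
    intro π hπ
    by_cases hπB : π = P.firstBlock
    · rwa [hπB]
    have hπM : π ∈ P.part.parts.erase P.firstBlock := Finset.mem_erase.2 ⟨hπB, hπ⟩
    have hS : 0 < (support (P.part.parts.erase P.firstBlock)).card := by
      obtain ⟨x, hx⟩ := P.parts_nonempty hπ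
      exact Finset.card_pos.2 ⟨x, subset_support hπM hx⟩
    have hpull := (isBoolean_iff_ordConnected _).1 (h hS) _
      ((P.mem_parts_restrict_support hsub _).2 ⟨π, hπM, rfl⟩)
    -- Convexity lifts from the restriction: a point x between two elements of π cannot lie in the
    -- first block, which precedes π, so x belongs to the restricted set.
    refine ⟨fun a ha b hb x hx => ?_⟩
    have haB : a ∉ P.firstBlock := fun h =>
      hπB (P.part.eq_of_mem_of_mem hπ P.firstBlock_mem ha h)
    by_cases hxB : x ∈ P.firstBlock
    · exact absurd (P.lt_of_mem_firstBlock hB hxB haB) (not_lt.2 hx.1)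
    obtain ⟨ρ, hρ, hxρ⟩ := P.part.exists_mem (Finset.mem_univ x)
    have hρM : ρ ∈ P.part.parts.erase P.firstBlock :=
      Finset.mem_erase.2 ⟨fun h => hxB (h ▸ hxρ), hρ⟩
    obtain ⟨a, rfl⟩ := exists_orderEmbOfFin_eq (subset_support hπM ha)
    obtain ⟨b, rfl⟩ := exists_orderEmbOfFin_eq (subset_support hπM hb)
    obtain ⟨x, rfl⟩ := exists_orderEmbOfFin_eq (subset_support hρM hxρ)
    exact mem_pull.1 (hpull.out (mem_pull.2 ha) (mem_pull.2 hb) (by simpa using hx))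

end NCP

/-! ### The two half-shuffle fixed point equations -/

section HalfShuffles

variable {K : Type*} [Field K]

theorem prec_one (f g : Module.Dual K (H K)) : prec f g 1 = 0 := by
  simp [prec, dualProduct, coproductPrec_one]

theorem succ_one (f g : Module.Dual K (H K)) : succ f g 1 = 0 := by
  simp [succ, dualProduct, coproductSucc_one]

/-- The left leg must be a single block containing the first element, which leaves one cut of P; in
the cuts of x the counit then contracts the left leg and gives back x. -/
theorem prec_e_ι_mul (φ : Module.Dual K (H K)) (P : NCP) (x : H K) :
    prec (e K) φ (FreeAlgebra.ι K P * x) = φ (gapMonomial K P P.firstBlock * x) := by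
  simp only [prec, dualProduct, LinearMap.comp_apply, coproductPrec_ι_mul, Finset.sum_mul, map_sum,
    cutTerm]
  rw [Finset.sum_eq_single {P.firstBlock}]
  · have hB : {P.firstBlock} ⊆ P.part.parts := by simpa using P.firstBlock_mem
    rw [map_e_left_mul, counitLeft_coproduct, e_st_support P hB, NCP.support_singleton]
    · simp
    · rw [NCP.support_singleton, counit_st, if_neg]
      exact Finset.nonempty_iff_ne_empty.1 ⟨_, P.first_mem_firstBlock⟩
  · intro L hL hne
    obtain ⟨hL, hfirst⟩ := Finset.mem_filter.1 hL
    have hLP := (NCP.mem_cuts.1 hL).1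
    rw [map_e_left_mul, e_st_support P hLP, if_neg, zero_mul]
    · intro hcard
      obtain ⟨π, rfl⟩ := Finset.card_eq_one.1 hcard
      rw [P.first_mem_support hLP, Finset.mem_singleton] at hfirst
      exact hne (by rw [hfirst])
    · rw [counit_st, if_neg]
      exact Finset.nonempty_iff_ne_empty.1 ⟨_, hfirst⟩
  · refine fun h => absurd (Finset.mem_filter.2 ⟨P.singleton_firstBlock_mem_cuts, ?_⟩) h
    rw [NCP.support_singleton]
    exact P.first_mem_firstBlock

open Classical in
-- The first element lies in the upperset, so the right leg coming from P is not a unit and `e` must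
-- fall on it, leaving x intact. Hence the upperset is the first block alone, which is a cut exactly
-- when this block is an interval.
theorem succ_e_ι_mul (φ : Module.Dual K (H K)) (P : NCP) (x : H K) :
    succ φ (e K) (FreeAlgebra.ι K P * x) =
      if (P.firstBlock : Set (Fin P.deg)).OrdConnected then
        φ (st K P (NCP.support (P.part.parts.erase P.firstBlock)) * x) else 0 := by
  have hterm : ∀ L ∈ P.cuts.filter fun L => P.first ∉ NCP.support L,
      LinearMap.mul' K K (TensorProduct.map φ (e K) (cutTerm K P L * coproduct K x)) =
        if (P.part.parts \ L).card = 1 then φ (st K P (NCP.support L) * x) else 0 := by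
    intro L hL
    obtain ⟨hL, hfirst⟩ := Finset.mem_filter.1 hL
    rw [map_e_right, eRight_mul, cutTerm, eRight_tmul, counitRight_tmul, e_gapMonomial P hL,
      counit_gapMonomial, counitRight_coproduct, if_neg (c := NCP.support L = Finset.univ)]
    · split_ifs <;> simp
    · intro h
      exact hfirst (h ▸ Finset.mem_univ _)
  simp only [succ, dualProduct, LinearMap.comp_apply, coproductSucc_ι_mul, Finset.sum_mul, map_sum]
  rw [Finset.sum_congr rfl hterm]
  have herase : ∀ L ∈ P.cuts.filter fun L => P.first ∉ NCP.support L,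
      (P.part.parts \ L).card = 1 → L = P.part.parts.erase P.firstBlock := by
    intro L hL hcard
    obtain ⟨hL, hfirst⟩ := Finset.mem_filter.1 hL
    have hLP := (NCP.mem_cuts.1 hL).1
    rw [P.first_mem_support hLP] at hfirst
    obtain ⟨ρ, hρ⟩ := Finset.card_eq_one.1 hcard
    have : P.firstBlock ∈ P.part.parts \ L := Finset.mem_sdiff.2 ⟨P.firstBlock_mem, hfirst⟩
    rw [hρ, Finset.mem_singleton] at this
    rw [← Finset.sdiff_singleton_eq_erase, this, ← hρ, Finset.sdiff_sdiff_eq_self hLP]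
  have hmem := (P.erase_mem_cuts P.firstBlock_mem).trans
    (P.forall_nests_iff_ordConnected P.firstBlock_mem)
  split_ifs with h
  · rw [Finset.sum_eq_single (P.part.parts.erase P.firstBlock)]
    · rw [if_pos]
      rw [← Finset.sdiff_singleton_eq_erase, Finset.sdiff_sdiff_eq_self]
      · simp
      · simpa using P.firstBlock_mem
    · exact fun L hL hne => if_neg fun hcard => hne (herase L hL hcard)
    · refine fun h' => absurd (Finset.mem_filter.2 ⟨hmem.2 h, ?_⟩) h'
      rw [P.first_mem_support (Finset.erase_subset _ _)]
      simp
  · refine Finset.sum_eq_zero fun L hL => if_neg fun hcard => h (hmem.1 ?_)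
    rw [← herase L hL hcard]
    exact (Finset.mem_filter.1 hL).1

theorem card_gap_lt {n : ℕ} {S : Finset (Fin n)} (hS : S.Nonempty) (i : ℕ) :
    (gap S i).card < n := by
  obtain ⟨x, hx⟩ := hS
  have : gap S i ⊂ Finset.univ :=
    Finset.ssubset_univ_iff.2 fun h => (mem_gap.1 (h ▸ Finset.mem_univ x : x ∈ gap S i)).1 hx
  simpa using Finset.card_lt_card this

/-- A solution of `d(P x) = d(U x)`, with `U` the gap monomial of the first block of `P`, is
constant along left multiplication by partitions. -/
theorem apply_ι_mul_of_firstBlock {d : Module.Dual K (H K)}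
    (hd : ∀ P x, d (FreeAlgebra.ι K P * x) = d (gapMonomial K P P.firstBlock * x)) (P : NCP)
    (x : H K) : d (FreeAlgebra.ι K P * x) = d x := by
  -- The cofactor x stays general, because the factors of the gap monomial are stripped one by one
  -- in front of varying remainders.
  induction hn : P.deg using Nat.strong_induction_on generalizing P x with
  | _ n ih =>
    subst hn
    have hst : ∀ i y, d (st K P (gap P.firstBlock i) * y) = d y := by
      intro i y
      by_cases h : 0 < (gap P.firstBlock i).card
      · rw [st_of_card_pos h]
        exact ih _ (card_gap_lt ⟨_, P.first_mem_firstBlock⟩ i) _ y rfl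
      · rw [Finset.card_pos, Finset.not_nonempty_iff_eq_empty] at h
        rw [h, st_empty, one_mul]
    rw [hd, gapMonomial]
    induction List.range (P.firstBlock.card + 1) with
    | nil => simp
    | cons i l ihl => rw [List.map_cons, List.prod_cons, mul_assoc, hst, ihl]

/-- The recursion determines φ on all monomials from φ(1) = 1; conversely the constant character
satisfies it because every gap monomial has value 1. -/
theorem isLeftHalfShuffleExp_e_iff (φ : Module.Dual K (H K)) :
    IsLeftHalfShuffleExp (e K) φ ↔
      φ = (FreeAlgebra.lift K fun _ : NCP => (1 : K)).toLinearMap := by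
  constructor
  · intro h
    have hφ : ∀ x, φ x = counit K x + prec (e K) φ x := fun x => LinearMap.congr_fun h x
    have hmul : ∀ P x, φ (FreeAlgebra.ι K P * x) = φ x :=
      apply_ι_mul_of_firstBlock fun P x => by
        rw [hφ, map_mul, counit_ι, zero_mul, zero_add, prec_e_ι_mul]
    refine linearMap_ext_of_ι_mul ?_ fun P x hx => ?_
    · simp [hφ 1, prec_one]
    · simp [hmul, hx]
  · rintro rfl
    refine linearMap_ext_of_ι_mul ?_ fun P x _ => ?_
    · simp [prec_one]
    · have hst : ∀ S : Finset (Fin P.deg),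
          FreeAlgebra.lift K (fun _ : NCP => (1 : K)) (st K P S) = 1 := by
        intro S
        rw [st]
        split_ifs <;> simp
      simp [prec_e_ι_mul, gapMonomial, map_list_prod, Function.comp_def, hst]

open Classical in
/-- The character with value `1` at boolean partitions and `0` at all others. -/
noncomputable def booleanCharacter : H K →ₐ[K] K :=
  FreeAlgebra.lift K fun P => if P.IsBoolean then 1 else 0

open Classical in
theorem booleanCharacter_ι (P : NCP) :
    booleanCharacter (FreeAlgebra.ι K P) = if (P.firstBlock : Set (Fin P.deg)).OrdConnected then
      booleanCharacter (st K P (NCP.support (P.part.parts.erase P.firstBlock))) else 0 := by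
  simp only [booleanCharacter, FreeAlgebra.lift_ι_apply, P.isBoolean_iff_firstBlock]
  by_cases h : (P.firstBlock : Set (Fin P.deg)).OrdConnected
  · by_cases hS : 0 < (NCP.support (P.part.parts.erase P.firstBlock)).card
    · simp [h, st_of_card_pos hS, hS]
    · simp [h, st, hS]
  · simp [h]

theorem isRightHalfShuffleExp_e_iff (φ : Module.Dual K (H K)) :
    IsRightHalfShuffleExp (e K) φ ↔ φ = booleanCharacter.toLinearMap := by
  classical
  constructor
  · intro h
    have hφ : ∀ x, φ x = counit K x + succ φ (e K) x := fun x => LinearMap.congr_fun h x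
    have hmul : ∀ P x,
        φ (FreeAlgebra.ι K P * x) = booleanCharacter (FreeAlgebra.ι K P) * φ x := by
      intro P x
      -- Deleting the first block leaves at most one partition in front of x, so x can stay fixed.
      induction hn : P.deg using Nat.strong_induction_on generalizing P with
      | _ n ih =>
        subst hn
        rw [hφ, map_mul, counit_ι, zero_mul, zero_add, succ_e_ι_mul, booleanCharacter_ι]
        split_ifs
        · by_cases hS : 0 < (NCP.support (P.part.parts.erase P.firstBlock)).card
          · rw [st_of_card_pos hS]
            refine ih _ ?_ _ rfl
            change (NCP.support _).card < _
            have : NCP.support (P.part.parts.erase P.firstBlock) ⊂ Finset.univ := by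
              rw [Finset.ssubset_univ_iff, Ne, P.support_eq_univ (Finset.erase_subset _ _),
                Finset.erase_eq_self, not_not]
              exact P.firstBlock_mem
            simpa using Finset.card_lt_card this
          · simp [st, hS]
        · rw [zero_mul]
    refine linearMap_ext_of_ι_mul ?_ fun P x hx => ?_
    · simp [hφ 1, succ_one]
    · rw [hmul, hx]
      simp
  · rintro rfl
    refine linearMap_ext_of_ι_mul ?_ fun P x _ => ?_
    · simp [succ_one]
    · simp [succ_e_ι_mul, booleanCharacter_ι P]

end HalfShuffles

/-! ### Counting heap orderings -/

/-- The number of numberings of `α` by `Fin k` that are monotone for the relation `R`. -/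
noncomputable def orderingCount (α : Type*) (R : α → α → Prop) (k : ℕ) : ℕ :=
  Nat.card {σ : α ≃ Fin k // ∀ a b, R a b → σ a ≤ σ b}

theorem orderingCount_congr {α β : Type*} {R : α → α → Prop} {S : β → β → Prop} {k l : ℕ}
    (f : α ≃ β) (hf : ∀ a b, R a b ↔ S (f a) (f b)) (hkl : k = l) :
    orderingCount α R k = orderingCount β S l := by
  subst hkl
  refine Nat.card_congr ((Equiv.equivCongr f (Equiv.refl _)).subtypeEquiv fun σ => ?_)
  simp only [Equiv.equivCongr_apply_apply, Equiv.refl_apply, hf]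
  exact ⟨fun h a b hab => h _ _ (by simpa using hab), fun h a b hab => by simpa using h _ _ hab⟩

theorem orderingCount_of_isEmpty {α : Type*} [IsEmpty α] (R : α → α → Prop) :
    orderingCount α R 0 = 1 := by
  rw [orderingCount, Nat.card_eq_one_iff_unique]
  exact ⟨inferInstance, ⟨⟨Equiv.equivOfIsEmpty _ _, fun a => isEmptyElim a⟩⟩⟩

open Classical in
/-- The numberings with `a` in the last position are the numberings of the other elements. -/
theorem card_orderings_last {α : Type*} (R : α → α → Prop) (k : ℕ) (a : α)
    (ha : ∀ b, R a b → b = a) :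
    Nat.card {σ : {σ : α ≃ Fin (k + 1) // ∀ a b, R a b → σ a ≤ σ b} // σ.1.symm (Fin.last k) = a} =
      orderingCount {b // b ≠ a} (fun b c => R b c) k := by
  -- Extends a numbering of the other elements by giving a the last number. This is monotone because
  -- a is related to nothing but possibly itself.
  let ext (τ : {b // b ≠ a} ≃ Fin k) : α ≃ Fin (k + 1) :=
    ((Equiv.optionSubtypeNe a).symm.trans (Equiv.optionCongr τ)).trans finSuccEquivLast.symm
  have hext_self : ∀ τ, ext τ a = Fin.last k := fun τ => by simp [ext]
  have hext : ∀ τ (b : {b // b ≠ a}), ext τ b = (τ b).castSucc := fun τ b => by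
    simp [ext, b.2]
  have hmono : ∀ τ : {b // b ≠ a} ≃ Fin k, (∀ b c : {b // b ≠ a}, R b c → τ b ≤ τ c) →
      ∀ b c, R b c → ext τ b ≤ ext τ c := by
    intro τ hτ b c hbc
    by_cases hc : c = a
    · rw [hc, hext_self]
      exact Fin.le_last _
    · by_cases hb : b = a
      · exact absurd (ha c (hb ▸ hbc)) hc
      · rw [hext τ ⟨b, hb⟩, hext τ ⟨c, hc⟩]
        exact hτ ⟨b, hb⟩ ⟨c, hc⟩ hbc
  have hlast : ∀ τ, (ext τ).symm (Fin.last k) = a := fun τ => by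
    rw [Equiv.symm_apply_eq, hext_self]
  refine (Nat.card_congr (Equiv.ofBijective (fun τ : {τ : {b // b ≠ a} ≃ Fin k //
      ∀ b c : {b // b ≠ a}, R b c → τ b ≤ τ c} =>
    (⟨⟨ext τ.1, hmono τ.1 τ.2⟩, hlast τ.1⟩ :
      {σ : {σ : α ≃ Fin (k + 1) // ∀ a b, R a b → σ a ≤ σ b} // σ.1.symm (Fin.last k) = a}))
    ⟨fun τ τ' h => ?_, fun σ => ?_⟩)).symm
  · refine Subtype.ext (Equiv.ext fun b => Fin.ext ?_)
    have h' : ext τ.1 = ext τ'.1 := congrArg (fun s => s.1.1) h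
    have := congrArg Fin.val (DFunLike.congr_fun h' b.1)
    rwa [hext, hext] at this
  · obtain ⟨⟨σ, hσ⟩, hσa⟩ := σ
    have hlast : σ a = Fin.last k := by rw [← hσa]; simp
    have hne : ∀ b : {b // b ≠ a}, σ b ≠ Fin.last k := fun b h =>
      b.2 (σ.injective (h.trans hlast.symm))
    let τ : {b // b ≠ a} ≃ Fin k := Equiv.ofBijective (fun b => (σ b).castPred (hne b)) <| by
      refine ⟨fun b c h => ?_, fun i => ?_⟩
      · exact Subtype.ext (σ.injective (by simpa using congrArg Fin.castSucc h))
      · refine ⟨⟨σ.symm i.castSucc, fun h => ?_⟩, by simp⟩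
        rw [Equiv.symm_apply_eq, hlast] at h
        exact Fin.castSucc_ne_last i h
    have hτ : ∀ b, (τ b).castSucc = σ b := fun b => Fin.castSucc_castPred _ (hne b)
    refine ⟨⟨τ, fun b c hbc => ?_⟩, ?_⟩
    · rw [← Fin.castSucc_le_castSucc_iff, hτ, hτ]
      exact hσ _ _ hbc
    · refine Subtype.ext (Subtype.ext (Equiv.ext fun b => ?_))
      by_cases hb : b = a
      · rw [hb, hlast]
        exact hext_self τ
      · exact (hext τ ⟨b, hb⟩).trans (hτ _)

/-- Numberings are counted by their last element. -/
theorem orderingCount_succ {α : Type*} [Fintype α] (R : α → α → Prop)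
    [DecidablePred fun a => ∀ b, R a b → b = a] (k : ℕ) :
    orderingCount α R (k + 1) =
      ∑ a : α with ∀ b, R a b → b = a, orderingCount {b // b ≠ a} (fun b c => R b c) k := by
  rw [Finset.sum_filter, orderingCount, ← Nat.card_congr (Equiv.sigmaFiberEquiv
    fun σ : {σ : α ≃ Fin (k + 1) // ∀ a b, R a b → σ a ≤ σ b} => σ.1.symm (Fin.last k)),
    Nat.card_sigma]
  refine Finset.sum_congr rfl fun a _ => ?_
  split_ifs with ha
  · exact card_orderings_last R k a ha
  · rw [Nat.card_eq_zero]
    -- If a has the last number, monotonicity forces the last number on everything a is related to;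
    -- so the fibre over any other a is empty.
    refine Or.inl ⟨fun ⟨⟨σ, hσ⟩, hσa⟩ => ha fun b hab => ?_⟩
    have hlast : σ a = Fin.last k := by rw [← hσa]; simp
    exact σ.injective ((Fin.last_le_iff.1 (hlast ▸ hσ a b hab)).trans hlast.symm)

namespace NCP

/-- The number of heap orderings of a set of blocks. -/
noncomputable def blockOrderings {n : ℕ} (M : Finset (Finset (Fin n))) : ℕ :=
  orderingCount {π // π ∈ M} (fun π ρ => Nests π.1 ρ.1) M.card

theorem ho_eq_blockOrderings (P : NCP) : P.ho = blockOrderings P.part.parts := rfl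

theorem nests_pull {n : ℕ} {S π ρ : Finset (Fin n)} (hπ : π ⊆ S) (hρ : ρ ⊆ S) :
    Nests (pull S π) (pull S ρ) ↔ Nests π ρ := by
  constructor
  · rintro ⟨x, hx, a, ha, b, hb, hax, hxb⟩
    exact ⟨_, mem_pull.1 hx, _, mem_pull.1 ha, _, mem_pull.1 hb, by simpa using hax,
      by simpa using hxb⟩
  · rintro ⟨x, hx, a, ha, b, hb, hax, hxb⟩
    obtain ⟨x, rfl⟩ := exists_orderEmbOfFin_eq (hρ hx)
    obtain ⟨a, rfl⟩ := exists_orderEmbOfFin_eq (hπ ha)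
    obtain ⟨b, rfl⟩ := exists_orderEmbOfFin_eq (hπ hb)
    exact ⟨x, mem_pull.2 hx, a, mem_pull.2 ha, b, mem_pull.2 hb, by simpa using hax,
      by simpa using hxb⟩

theorem ho_restrict_support (P : NCP) {M : Finset (Finset (Fin P.deg))} (hM : M ⊆ P.part.parts)
    (hS : 0 < (support M).card) : (P.restrict (support M) hS).ho = blockOrderings M := by
  refine (orderingCount_congr (Equiv.ofBijective
    (fun π : {π // π ∈ M} => (⟨pull (support M) π.1,
      (P.mem_parts_restrict_support hM _).2 ⟨π.1, π.2, rfl⟩⟩ :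
        {A // A ∈ (P.restrict (support M) hS).part.parts})) ⟨fun π ρ h => ?_, fun A => ?_⟩)
    (fun π ρ => ?_) (P.numBlocks_restrict_support hM hS).symm).symm
  · exact Subtype.ext (P.pull_support_injOn hM π.2 ρ.2 (congrArg Subtype.val h))
  · obtain ⟨π, hπ, h⟩ := (P.mem_parts_restrict_support hM _).1 A.2
    exact ⟨⟨π, hπ⟩, Subtype.ext h⟩
  · exact (nests_pull (subset_support π.2) (subset_support ρ.2)).symm

/-- Heap orderings are counted by their last block. -/
theorem ho_eq_sum (P : NCP) :
    P.ho = ∑ L ∈ P.cuts with (P.part.parts \ L).card = 1, blockOrderings L := by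
  classical
  obtain ⟨k, hk⟩ := Nat.exists_eq_succ_of_ne_zero P.numBlocks_pos.ne'
  have hk' : P.part.parts.card = k + 1 := hk
  rw [ho_eq_blockOrderings, blockOrderings, hk', orderingCount_succ]
  -- The possible last blocks ρ are those with nothing nested inside, and they match the cuts with a
  -- one-block upperset through ρ ↦ the remaining blocks.
  refine Finset.sum_bij (fun ρ _ => P.part.parts.erase ρ.1) ?_ ?_ ?_ ?_
  · intro ρ hρ
    rw [Finset.mem_filter] at hρ ⊢
    refine ⟨(P.erase_mem_cuts ρ.2).2 fun π hπ h => ?_, ?_⟩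
    · exact congrArg Subtype.val (hρ.2 ⟨π, hπ⟩ h)
    · rw [← Finset.sdiff_singleton_eq_erase, Finset.sdiff_sdiff_eq_self (by simp [ρ.2])]
      simp
  · intro ρ _ ρ' _ h
    exact Subtype.ext (Finset.erase_injOn _ ρ.2 ρ'.2 h)
  · intro L hL
    obtain ⟨hL, hcard⟩ := Finset.mem_filter.1 hL
    obtain ⟨ρ, hρ⟩ := Finset.card_eq_one.1 hcard
    have hρP : ρ ∈ P.part.parts :=
      (Finset.mem_sdiff.1 (hρ ▸ Finset.mem_singleton_self ρ : ρ ∈ P.part.parts \ L)).1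
    have hLe : P.part.parts.erase ρ = L := by
      rw [← Finset.sdiff_singleton_eq_erase, ← hρ,
        Finset.sdiff_sdiff_eq_self (mem_cuts.1 hL).1]
    refine ⟨⟨ρ, hρP⟩, Finset.mem_filter.2 ⟨Finset.mem_univ _, fun π h => ?_⟩, hLe⟩
    exact Subtype.ext ((P.erase_mem_cuts hρP).1 (hLe ▸ hL) π.1 π.2 h)
  · intro ρ _
    refine orderingCount_congr
      (Equiv.ofBijective (fun π : {π : {π // π ∈ P.part.parts} // π ≠ ρ} =>
        (⟨π.1.1, Finset.mem_erase.2 ⟨fun h => π.2 (Subtype.ext h), π.1.2⟩⟩ :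
          {π // π ∈ P.part.parts.erase ρ.1})) ⟨fun π π' h => ?_, fun π => ?_⟩)
      (fun _ _ => Iff.rfl) ?_
    · have h' : π.1.1 = π'.1.1 := congrArg (fun t => t.1) h
      exact Subtype.ext (Subtype.ext h')
    · obtain ⟨hne, hπ⟩ := Finset.mem_erase.1 π.2
      exact ⟨⟨⟨π.1, hπ⟩, fun h => hne (congrArg Subtype.val h)⟩, rfl⟩
    · rw [Finset.card_erase_of_mem ρ.2, hk']
      rfl

end NCP

/-! ### The convolution exponential -/

section Exponential

variable {K : Type*} [Field K]

/-- The derivation `(id ⊗ e) ∘ Δ`, which sums over the deletions of a block without nested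
blocks. -/
noncomputable def deletion : H K →ₗ[K] H K := eRight ∘ₗ (coproduct K).toLinearMap

/-- `eRight` is a derivation over `counitRight`, which undoes Δ. -/
theorem deletion_mul (x y : H K) : deletion (x * y) = deletion x * y + x * deletion y := by
  simp [deletion, eRight_mul, counitRight_coproduct]

theorem deletion_one : deletion (1 : H K) = 0 := by
  simpa using deletion_mul (1 : H K) 1

theorem deletion_ι (P : NCP) :
    deletion (FreeAlgebra.ι K P) =
      ∑ L ∈ P.cuts with (P.part.parts \ L).card = 1, st K P (NCP.support L) := by
  simp only [deletion, LinearMap.comp_apply, AlgHom.toLinearMap_apply, coproduct,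
    FreeAlgebra.lift_ι_apply, map_sum, cutTerm, eRight_tmul, Finset.sum_filter]
  refine Finset.sum_congr rfl fun L hL => ?_
  rw [e_gapMonomial P hL]
  split_ifs <;> simp

/-- Convolving with `e` on the right is precomposition with `deletion`. -/
theorem convPow_e (n : ℕ) (x : H K) :
    convPow (e K) n x = counit K ((deletion ^ n : H K →ₗ[K] H K) x) := by
  induction n generalizing x with
  | zero => simp [convPow]
  | succ n ih =>
    rw [convPow, conv, dualProduct, LinearMap.comp_apply, LinearMap.comp_apply, map_e_right, ih,
      pow_succ]
    rfl

/-- The elements that are homogeneous for the number of blocks. -/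
inductive IsHomogeneous : ℕ → H K → Prop
  | zero (n : ℕ) : IsHomogeneous n 0
  | one : IsHomogeneous 0 1
  | ι_mul (P : NCP) {n : ℕ} {x : H K} :
      IsHomogeneous n x → IsHomogeneous (P.numBlocks + n) (FreeAlgebra.ι K P * x)
  | add {n : ℕ} {x y : H K} : IsHomogeneous n x → IsHomogeneous n y → IsHomogeneous n (x + y)

theorem IsHomogeneous.mul {m n : ℕ} {x y : H K} (hx : IsHomogeneous m x)
    (hy : IsHomogeneous n y) : IsHomogeneous (m + n) (x * y) := by
  induction hx with
  | zero m => simpa using IsHomogeneous.zero _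
  | one => simpa using hy
  | ι_mul P _ ih => simpa [mul_assoc, add_assoc] using IsHomogeneous.ι_mul P ih
  | add _ _ ih ih' => simpa [add_mul] using ih.add ih'

theorem IsHomogeneous.ι (P : NCP) : IsHomogeneous P.numBlocks (FreeAlgebra.ι K P) := by
  simpa using IsHomogeneous.ι_mul (K := K) P .one

theorem IsHomogeneous.sum {ι : Type*} {s : Finset ι} {n : ℕ} {f : ι → H K}
    (h : ∀ i ∈ s, IsHomogeneous n (f i)) : IsHomogeneous n (∑ i ∈ s, f i) :=
  Finset.sum_induction f _ (fun _ _ => .add) (.zero n) h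

theorem isHomogeneous_st_support (P : NCP) {M : Finset (Finset (Fin P.deg))}
    (hM : M ⊆ P.part.parts) : IsHomogeneous M.card (st K P (NCP.support M)) := by
  by_cases h : 0 < (NCP.support M).card
  · rw [st_of_card_pos h, ← P.numBlocks_restrict_support hM h]
    exact .ι _
  · rw [Finset.card_pos, Finset.not_nonempty_iff_eq_empty] at h
    rw [h, st_empty, (P.support_eq_empty hM).1 h]
    exact .one

theorem isHomogeneous_deletion_ι (P : NCP) :
    IsHomogeneous (P.numBlocks - 1) (deletion (FreeAlgebra.ι K P)) := by
  rw [deletion_ι]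
  refine .sum fun L hL => ?_
  obtain ⟨hL, hcard⟩ := Finset.mem_filter.1 hL
  have hLP := (NCP.mem_cuts.1 hL).1
  rw [Finset.card_sdiff_of_subset hLP] at hcard
  have : P.numBlocks - 1 = L.card := by
    have := Finset.card_le_card hLP
    rw [NCP.numBlocks]
    omega
  rw [this]
  exact isHomogeneous_st_support P hLP

/-- The vanishing in degree 0 is carried along because the subtraction `n - 1` is truncated there.
-/
theorem IsHomogeneous.deletion {n : ℕ} {x : H K} (hx : IsHomogeneous n x) :
    (n = 0 → NoncrossingShuffle.deletion x = 0) ∧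
      IsHomogeneous (n - 1) (NoncrossingShuffle.deletion x) := by
  induction hx with
  | zero n => simpa using IsHomogeneous.zero _
  | one => simpa [deletion_one] using IsHomogeneous.zero _
  | add _ _ ih ih' =>
    rw [map_add]
    exact ⟨fun h => by rw [ih.1 h, ih'.1 h, add_zero], ih.2.add ih'.2⟩
  | @ι_mul P n x hx ih =>
    have hP := P.numBlocks_pos
    refine ⟨fun h => by omega, ?_⟩
    rw [deletion_mul]
    refine .add ?_ ?_
    · have := (isHomogeneous_deletion_ι (K := K) P).mul hx
      rwa [show P.numBlocks + n - 1 = P.numBlocks - 1 + n by omega]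
    -- For n = 0 the degrees do not match, but then deletion kills x.
    · rcases Nat.eq_zero_or_pos n with h0 | h0
      · rw [ih.1 h0, mul_zero]
        exact .zero _
      · rw [show P.numBlocks + n - 1 = P.numBlocks + (n - 1) by omega]
        exact .ι_mul P ih.2

/-- The character with value `ho(P) / k!` at a partition `P` with `k` blocks. -/
noncomputable def heapCharacter : H K →ₐ[K] K :=
  FreeAlgebra.lift K fun P => (P.ho : K) / (P.numBlocks.factorial : K)

theorem heapCharacter_ι (P : NCP) :
    heapCharacter (FreeAlgebra.ι K P) = (P.ho : K) / (P.numBlocks.factorial : K) := by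
  simp [heapCharacter]

theorem heapCharacter_st_support (P : NCP) {M : Finset (Finset (Fin P.deg))}
    (hM : M ⊆ P.part.parts) :
    heapCharacter (st K P (NCP.support M)) =
      (NCP.blockOrderings M : K) / (M.card.factorial : K) := by
  by_cases h : 0 < (NCP.support M).card
  · rw [st_of_card_pos h, heapCharacter_ι, P.numBlocks_restrict_support hM h,
      P.ho_restrict_support hM h]
  · rw [Finset.card_pos, Finset.not_nonempty_iff_eq_empty] at h
    rw [h, st_empty, (P.support_eq_empty hM).1 h, NCP.blockOrderings, Finset.card_empty,
      orderingCount_of_isEmpty]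
    simp

/-- Degree 0 consists of scalars, on which all characters agree; the counit kills positive degrees.
-/
theorem IsHomogeneous.counit_eq {n : ℕ} {x : H K} (hx : IsHomogeneous n x) :
    counit K x = if n = 0 then heapCharacter x else 0 := by
  induction hx with
  | zero n => simp
  | one => simp
  | add _ _ ih ih' => rw [map_add, map_add, ih, ih']; split_ifs <;> simp
  | ι_mul P _ ih =>
    have hP := P.numBlocks_pos
    rw [if_neg (by omega), map_mul, counit_ι, zero_mul]

variable [CharZero K]

/-- With k + 1 blocks, each deletion contributes its number of heap orderings over k!. By
`ho_eq_sum` the total is ho(P)/k! = (k + 1) ho(P)/(k + 1)!. -/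
theorem heapCharacter_deletion_ι (P : NCP) :
    heapCharacter (deletion (FreeAlgebra.ι K P)) =
      (P.numBlocks : K) * heapCharacter (FreeAlgebra.ι K P) := by
  obtain ⟨k, hk⟩ := Nat.exists_eq_succ_of_ne_zero P.numBlocks_pos.ne'
  have hterm : ∀ L ∈ P.cuts.filter fun L => (P.part.parts \ L).card = 1,
      heapCharacter (st K P (NCP.support L)) =
        (NCP.blockOrderings L : K) / (k.factorial : K) := by
    intro L hL
    obtain ⟨hL, hcard⟩ := Finset.mem_filter.1 hL
    have hLP := (NCP.mem_cuts.1 hL).1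
    rw [Finset.card_sdiff_of_subset hLP] at hcard
    rw [heapCharacter_st_support P hLP]
    have : L.card = k := by
      have := Finset.card_le_card hLP
      rw [NCP.numBlocks] at hk
      omega
    rw [this]
  rw [deletion_ι, map_sum, Finset.sum_congr rfl hterm, ← Finset.sum_div, heapCharacter_ι, hk,
    P.ho_eq_sum, Nat.succ_eq_add_one, Nat.factorial_succ]
  have h1 : ((k + 1 : ℕ) : K) ≠ 0 := Nat.cast_ne_zero.2 k.succ_ne_zero
  have h2 : (k.factorial : K) ≠ 0 := Nat.cast_ne_zero.2 k.factorial_ne_zero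
  rw [Nat.cast_mul, Nat.cast_sum]
  field_simp

/-- Both sides obey the same Leibniz rule, so the case of a single partition suffices. -/
theorem IsHomogeneous.heapCharacter_deletion {n : ℕ} {x : H K} (hx : IsHomogeneous n x) :
    heapCharacter (NoncrossingShuffle.deletion x) = (n : K) * heapCharacter x := by
  induction hx with
  | zero n => simp
  | one => simp [deletion_one]
  | add _ _ ih ih' => simp only [map_add, ih, ih', mul_add]
  | ι_mul P _ ih =>
    rw [deletion_mul, map_add, map_mul, map_mul, map_mul, heapCharacter_deletion_ι, ih]
    push_cast
    ring

/-- Successive deletions contribute the factors n, n − 1, …, 1; the final counit is non-zero only if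
degree 0 has been reached exactly. -/
theorem IsHomogeneous.convPow_e {n : ℕ} {x : H K} (hx : IsHomogeneous n x) (m : ℕ) :
    convPow (e K) m x = if m = n then (n.factorial : K) * heapCharacter x else 0 := by
  rw [NoncrossingShuffle.convPow_e]
  induction m generalizing n x with
  | zero =>
    rw [pow_zero, Module.End.one_apply, hx.counit_eq]
    rcases Nat.eq_zero_or_pos n with rfl | h
    · simp
    · rw [if_neg h.ne', if_neg h.ne]
  | succ m ih =>
    rw [pow_succ, Module.End.mul_apply]
    cases n with
    | zero => simp [hx.deletion.1 rfl]
    | succ n =>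
      rw [ih hx.deletion.2, Nat.add_sub_cancel, hx.heapCharacter_deletion, Nat.factorial_succ]
      simp only [Nat.add_right_cancel_iff]
      split_ifs
      · push_cast
        ring
      · rfl

theorem isConvExp_heapCharacter : IsConvExp (e K) (heapCharacter (K := K)).toLinearMap := by
  have hbasis : ∀ w, ∃ n, IsHomogeneous n (monomialBasis K w) := by
    intro w
    induction w using FreeMonoid.inductionOn' with
    | one => exact ⟨0, monomialBasis_one (K := K) ▸ .one⟩
    | of_mul P w ih =>
      obtain ⟨n, hn⟩ := ih
      exact ⟨_, (monomialBasis_of_mul (K := K) P w).symm ▸ IsHomogeneous.ι_mul P hn⟩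
  intro x
  -- `finsum` is additive only on finitely supported families, so finiteness is proved together with
  -- the value.
  have hsupp : ∀ (x : H K), (Function.support fun n : ℕ => convPow (e K) n x).Finite →
      (Function.support fun n : ℕ => (n.factorial : K)⁻¹ * convPow (e K) n x).Finite :=
    fun x h => h.subset (Function.support_mul_subset_right _ _)
  induction (monomialBasis K).mem_span x using Submodule.span_induction with
  | zero => simp
  | smul c x _ ih =>
    have : ∀ n, convPow (e K) n (c • x) = c * convPow (e K) n x := fun n => by simp
    simp only [this]
    refine ⟨ih.1.subset (Function.support_mul_subset_right _ _), ?_⟩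
    rw [map_smul, ih.2, smul_eq_mul, mul_finsum]
    exact finsum_congr fun n => by ring
  | add x y _ _ ihx ihy =>
    simp only [map_add, mul_add]
    refine ⟨(ihx.1.union ihy.1).subset (Function.support_add _ _), ?_⟩
    rw [ihx.2, ihy.2, finsum_add_distrib (hsupp x ihx.1) (hsupp y ihy.1)]
  | mem x hx =>
    -- A monomial is homogeneous, so the series has at most one non-zero term, and the factorials
    -- cancel.
    obtain ⟨w, rfl⟩ := hx
    obtain ⟨n, hn⟩ := hbasis w
    simp only [hn.convPow_e]
    refine ⟨(Set.finite_singleton n).subset fun m hm => ?_, ?_⟩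
    · by_contra h
      exact hm (if_neg h)
    · rw [finsum_eq_single _ n fun m hm => by rw [if_neg hm, mul_zero], if_pos rfl,
        inv_mul_cancel_left₀ (Nat.cast_ne_zero.2 n.factorial_ne_zero)]
      rfl

theorem isConvExp_e_iff (φ : Module.Dual K (H K)) :
    IsConvExp (e K) φ ↔ φ = heapCharacter.toLinearMap := by
  constructor
  · intro h
    ext x
    rw [(h x).2, (isConvExp_heapCharacter x).2]
  · rintro rfl
    exact isConvExp_heapCharacter

end Exponential

end NoncrossingShuffle

open NoncrossingShuffle in
theorem mainTheorem4 (K : Type*) [Field K] [CharZero K] :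
    (∃ ψprec : H K →ₐ[K] K,
      (∀ φ : Module.Dual K (H K), IsLeftHalfShuffleExp (e K) φ ↔ φ = ψprec.toLinearMap) ∧
      (∀ P : NCP, ψprec (FreeAlgebra.ι K P) = 1) ∧
      ψprec = (zeta K).comp (abelianization K)) ∧
    (∃ ψsucc : H K →ₐ[K] K,
      (∀ φ : Module.Dual K (H K), IsRightHalfShuffleExp (e K) φ ↔ φ = ψsucc.toLinearMap) ∧
      ∀ P : NCP, (P.IsBoolean → ψsucc (FreeAlgebra.ι K P) = 1) ∧
        (¬ P.IsBoolean → ψsucc (FreeAlgebra.ι K P) = 0)) ∧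
    (∃ ψstar : H K →ₐ[K] K,
      (∀ φ : Module.Dual K (H K), IsConvExp (e K) φ ↔ φ = ψstar.toLinearMap) ∧
      ∀ P : NCP, ψstar (FreeAlgebra.ι K P) = (P.ho : K) / (P.numBlocks.factorial : K)) := by
  refine ⟨⟨_, isLeftHalfShuffleExp_e_iff, fun P => FreeAlgebra.lift_ι_apply _ _, ?_⟩,
    ⟨_, isRightHalfShuffleExp_e_iff, fun P => ⟨fun h => ?_, fun h => ?_⟩⟩,
    ⟨_, isConvExp_e_iff, heapCharacter_ι⟩⟩
  · ext P
    simp [zeta, abelianization]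
  · simp [booleanCharacter, h]
  · simp [booleanCharacter, h]
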